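/- Let $B$ be a category. Let $\mathsf{Fib}(B)$ be the following 2-category. Its objects are the pairs $(A,f)$ where $A$ is a small category and $f\colon A\to B$ is a fibration equipped with a fixed (not necessarily normal) cleavage, i.e. a choice of cartesian liftings. Its 1-cells $(A,f)\to(C,g)$ are the functors $p\colon A\to C$ with $gp=f$ that send chosen cartesian liftings to chosen cartesian liftings. Its 2-cells are the natural transformations whose components are vertical, i.e. are sent to identities of $B$. In a (strict) 2-category, the *identee* of a 1-cell $p\colon A\to C$ is the 2-universal 2-cell $\kappa\colon k_0\Rightarrow k_1\colon K\to A$ such that $p\kappa$ is an identity. The *coinverter* of a 2-cell $\alpha\colon k_0\Rightarrow k_1\colon K\to A$ is a 1-cell $q\colon A\to Q$ such that: $q\alpha$ is invertible; for every 1-cell $f\colon A\to X$ with $f\alpha$ invertible there is a unique $t\colon Q\to X$ with $tq=f$; and for every 2-cell $\beta$ between 1-cells $g,h\colon A\to X$ with $g\alpha$ and $h\alpha$ invertible there is a unique 2-cell $\gamma$ (between the induced 1-cells $Q\to X$) with $\gamma q=\beta$. A 1-cell $p\colon A\to C$ is an *internal opfibration* if, for all $X$, the functor $\mathrm{Hom}(X,p)\colon\mathrm{Hom}(X,A)\to\mathrm{Hom}(X,C)$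 is an opfibration of categories and, for all $g\colon Y\to X$, precomposition with $g$ sends $\mathrm{Hom}(X,p)$-opcartesian morphisms to $\mathrm{Hom}(Y,p)$-opcartesian ones; it is an *internal opfibration in groupoids* if moreover its identee exists and is an invertible 2-cell. A 1-cell $p\colon(A,f)\to(C,g)$ in $\mathsf{Fib}(B)$ is a *fibrewise opfibration* (resp. a *fibrewise opfibration in groupoids*) if for every object $b$ of $B$ its restriction $p_b\colon A_b\to C_b$ to the fibres over $b$ is an opfibration (resp. an opfibration whose fibres are groupoids). **Proposition.** Let $p\colon(A,f)\to(C,g)$ be a fibrewise opfibration (resp. an internal opfibration) in $\mathsf{Fib}(B)$. Then there are an object $(Q',h')$ and 1-cells $q'\colon(A,f)\to(Q',h')$ and $s'\colon(Q',h')\to(C,g)$ of $\mathsf{Fib}(B)$ such that $p=s'q'$, where $q'$ is the coinverter in $\mathsf{Fib}(B)$ of the identee of $p$ (which exists in $\mathsf{Fib}(B)$), and $s'$ is a fibrewise opfibration in groupoids (resp. an internal opfibration in groupoids) in $\mathsf{Fib}(B)$. -/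

import Mathlib

open CategoryTheory

universe w v u

/-! ## Notions internal to a strict 2-category -/

namespace TwoCategory

open Bicategory

variable {𝒞 : Type u} [Bicategory.{w, v} 𝒞] [Bicategory.Strict 𝒞]

/-- A 2-cell `α : f ⟶ g` is an identity: its source and target are the same 1-cell and `α` is the
identity of that 1-cell. -/
def IsIdentityCell {X Y : 𝒞} {f g : X ⟶ Y} (α : f ⟶ g) : Prop :=
  ∃ h : f = g, α = eqToHom h

/-- `(K, κ)` is the identee of `p : A ⟶ C`: the 2-cell `κ : k₀ ⟶ k₁ : K ⟶ A` is 2-universal among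
the 2-cells with codomain `A` whose composite with `p` is an identity. In other words, for every
`X`, whiskering with `κ` is an isomorphism from the category of 1-cells `X ⟶ K` onto the category
whose objects are the 2-cells `α` between 1-cells `X ⟶ A` with `α ▷ p` an identity and whose
morphisms are the commutative squares. -/
structure IsIdentee {K A C : 𝒞} (p : A ⟶ C) {k₀ k₁ : K ⟶ A} (κ : k₀ ⟶ k₁) : Prop where
  isIdentity : IsIdentityCell (κ ▷ p)
  one_dim : ∀ (X : 𝒞) (a₀ a₁ : X ⟶ A) (α : a₀ ⟶ a₁), IsIdentityCell (α ▷ p) →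
    ∃! t : X ⟶ K, Arrow.mk (t ◁ κ) = Arrow.mk α
  two_dim : ∀ (X : 𝒞) (s t : X ⟶ K) (ξ₀ : s ≫ k₀ ⟶ t ≫ k₀) (ξ₁ : s ≫ k₁ ⟶ t ≫ k₁),
    ξ₀ ≫ t ◁ κ = s ◁ κ ≫ ξ₁ → ∃! θ : s ⟶ t, θ ▷ k₀ = ξ₀ ∧ θ ▷ k₁ = ξ₁

/-- `q : A ⟶ Q` is the (strict) coinverter of the 2-cell `α : k₀ ⟶ k₁ : K ⟶ A`. In the
two-dimensional property, the 1-cells out of `A` that invert `α` are written, as the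
one-dimensional property allows, in the form `q ≫ g` and `q ≫ h`. -/
structure IsCoinverter {K A Q : 𝒞} {k₀ k₁ : K ⟶ A} (α : k₀ ⟶ k₁) (q : A ⟶ Q) : Prop where
  isIso : IsIso (α ▷ q)
  one_dim : ∀ (X : 𝒞) (f : A ⟶ X), IsIso (α ▷ f) → ∃! t : Q ⟶ X, q ≫ t = f
  two_dim : ∀ (X : 𝒞) (g h : Q ⟶ X) (β : q ≫ g ⟶ q ≫ h), ∃! γ : g ⟶ h, q ◁ γ = β

/-- `q` is the coinverter of the identee of `p`. -/
def IsCoinverterOfIdentee {A C Q : 𝒞} (p : A ⟶ C) (q : A ⟶ Q) : Prop :=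
  ∃ (K : 𝒞) (k₀ k₁ : K ⟶ A) (κ : k₀ ⟶ k₁), IsIdentee p κ ∧ IsCoinverter κ q

end TwoCategory

/-! ## Opfibrations of categories -/

namespace CatOpfibration

/-- A morphism `φ` is (strongly) opcartesian with respect to a functor `F`. -/
def IsOpcartesian {X : Type*} {S : Type*} [Category X] [Category S] (F : X ⥤ S) {a b : X}
    (φ : a ⟶ b) : Prop :=
  F.IsStronglyCocartesian (F.map φ) φ

/-- A functor is a (Grothendieck) opfibration: every morphism out of the image of an object `a`
has a strongly opcartesian lift with domain `a`. -/
def IsOpfibration {X : Type*} {S : Type*} [Category X] [Category S] (F : X ⥤ S) : Prop :=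
  ∀ (a : X) (s : S) (β : F.obj a ⟶ s), ∃ (b : X) (φ : a ⟶ b), F.IsStronglyCocartesian β φ

/-- The fibres of a functor are groupoids. -/
def HasGroupoidFibres {X : Type*} {S : Type*} [Category X] [Category S] (F : X ⥤ S) : Prop :=
  ∀ (s : S) (a b : F.Fiber s) (φ : a ⟶ b), IsIso φ

/-- A functor is an opfibration in groupoids. -/
def IsOpfibrationInGroupoids {X : Type*} {S : Type*} [Category X] [Category S] (F : X ⥤ S) :
    Prop :=
  IsOpfibration F ∧ HasGroupoidFibres F

end CatOpfibration

/-! ## Internal opfibrations in a strict 2-category -/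

namespace TwoCategory

open Bicategory CatOpfibration

variable {𝒞 : Type u} [Bicategory.{w, v} 𝒞] [Bicategory.Strict 𝒞]

/-- A 1-cell `p : A ⟶ C` is an internal opfibration: composition with `p` is an opfibration
`(X ⟶ A) ⥤ (X ⟶ C)` for every `X`, and composition with any `g : Y ⟶ X` preserves the
opcartesian morphisms of these opfibrations. -/
structure IsInternalOpfibration {A C : 𝒞} (p : A ⟶ C) : Prop where
  isOpfibration : ∀ X : 𝒞, IsOpfibration (postcomp X p)
  preserves : ∀ (X Y : 𝒞) (g : Y ⟶ X) (a₀ a₁ : X ⟶ A) (α : a₀ ⟶ a₁),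
    IsOpcartesian (postcomp X p) α → IsOpcartesian (postcomp Y p) (g ◁ α)

/-- A 1-cell is an internal opfibration in groupoids: an internal opfibration whose identee is an
isomorphism. -/
def IsInternalOpfibrationInGroupoids {A C : 𝒞} (p : A ⟶ C) : Prop :=
  IsInternalOpfibration p ∧
    ∃ (K : 𝒞) (k₀ k₁ : K ⟶ A) (κ : k₀ ⟶ k₁), IsIdentee p κ ∧ IsIso κ

end TwoCategory

/-! ## The 2-category `Fib(B)` -/

universe v₁ u₁

/-- A cleavage of a functor `p`: a choice, for every `a` over `S` and every `β : R ⟶ S`, of a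
(strongly) cartesian morphism over `β` with codomain `a`. No normality is assumed. -/
structure Cleavage {B : Type*} {X : Type*} [Category B] [Category X] (p : X ⥤ B) where
  /-- the domain of the chosen lift -/
  dom : ∀ {R S : B} (_ : R ⟶ S) (a : X), p.obj a = S → X
  /-- the chosen lift -/
  lift : ∀ {R S : B} (β : R ⟶ S) (a : X) (ha : p.obj a = S), dom β a ha ⟶ a
  isStronglyCartesian : ∀ {R S : B} (β : R ⟶ S) (a : X) (ha : p.obj a = S),
    p.IsStronglyCartesian β (lift β a ha)

/-- An object of `Fib(B)`: a small category fibred over `B`, with a fixed cleavage. -/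
structure Fib (B : Type u₁) [Category.{v₁} B] where
  /-- the underlying category over `B` -/
  based : BasedCategory.{u, u} B
  /-- the cleavage -/
  cleavage : Cleavage based.p

namespace Fib

variable {B : Type u₁} [Category.{v₁} B]

/-- A functor over `B` sends the chosen cartesian lifts to the chosen cartesian lifts. -/
def PreservesCleavage {X Y : Fib.{u} B} (F : BasedFunctor X.based Y.based) : Prop :=
  ∀ ⦃R S : B⦄ (β : R ⟶ S) (a : X.based.obj) (ha : X.based.p.obj a = S),
    Over.mk (F.map (X.cleavage.lift β a ha)) =
      Over.mk (Y.cleavage.lift β (F.obj a) ((F.w_obj a).trans ha))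

/-- A 1-cell of `Fib(B)`: a functor over `B` that strictly preserves the cleavages. -/
structure Mor (X Y : Fib.{u} B) where
  /-- the underlying functor over `B` -/
  toBased : BasedFunctor X.based Y.based
  preserves : PreservesCleavage toBased

/-- The 2-cells of `Fib(B)` are the natural transformations with vertical components. -/
instance (X Y : Fib.{u} B) : Category (Mor X Y) where
  Hom F G := F.toBased ⟶ G.toBased
  id F := 𝟙 F.toBased
  comp α β := BasedNatTrans.comp α β

/-- The identity 1-cell. -/
def Mor.id (X : Fib.{u} B) : Mor X X where
  toBased := BasedFunctor.id X.based
  preserves _ _ _ _ _ := rfl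

/-- The composite of two 1-cells. -/
def Mor.comp {X Y Z : Fib.{u} B} (F : Mor X Y) (G : Mor Y Z) : Mor X Z where
  toBased := BasedFunctor.comp F.toBased G.toBased
  preserves R S β a ha := by
    have h := congrArg (Over.post (X := F.toBased.obj a) G.toBased.toFunctor).obj
      (F.preserves β a ha)
    exact h.trans (G.preserves β (F.toBased.obj a) ((F.toBased.w_obj a).trans ha))

instance : CategoryStruct (Fib.{u} B) where
  Hom X Y := Mor X Y
  id X := Mor.id X
  comp F G := Mor.comp F G

/-- An invertible 2-cell of categories over `B` between 1-cells of `Fib(B)`. -/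
def isoMk {X Y : Fib.{u} B} {F G : Mor X Y} (e : F.toBased ≅ G.toBased) : F ≅ G where
  hom := e.hom
  inv := e.inv
  hom_inv_id := e.hom_inv_id
  inv_hom_id := e.inv_hom_id

/-- The 2-category of (cloven) fibrations over `B`. -/
instance : Bicategory (Fib.{u} B) where
  homCategory X Y := inferInstanceAs (Category (Mor X Y))
  whiskerLeft F _ _ α := BasedCategory.whiskerLeft F.toBased α
  whiskerRight α H := BasedCategory.whiskerRight α H.toBased
  associator _ _ _ := isoMk (BasedNatIso.id _)
  leftUnitor _ := isoMk (BasedNatIso.id _)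
  rightUnitor _ := isoMk (BasedNatIso.id _)
  whiskerLeft_id F G :=
    Bicategory.whiskerLeft_id (B := BasedCategory.{u, u} B) F.toBased G.toBased
  whiskerLeft_comp F _ _ _ η θ :=
    Bicategory.whiskerLeft_comp (B := BasedCategory.{u, u} B) F.toBased (show _ ⟶ _ from η) θ
  id_whiskerLeft η := Bicategory.id_whiskerLeft (B := BasedCategory.{u, u} B) η
  comp_whiskerLeft F G _ _ η :=
    Bicategory.comp_whiskerLeft (B := BasedCategory.{u, u} B) F.toBased G.toBased η
  id_whiskerRight F G :=
    Bicategory.id_whiskerRight (B := BasedCategory.{u, u} B) F.toBased G.toBased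
  comp_whiskerRight η θ H :=
    Bicategory.comp_whiskerRight (B := BasedCategory.{u, u} B) η θ H.toBased
  whiskerRight_id η := Bicategory.whiskerRight_id (B := BasedCategory.{u, u} B) η
  whiskerRight_comp η G H :=
    Bicategory.whiskerRight_comp (B := BasedCategory.{u, u} B) η G.toBased H.toBased
  whisker_assoc F _ _ η H :=
    Bicategory.whisker_assoc (B := BasedCategory.{u, u} B) F.toBased η H.toBased
  whisker_exchange η θ := Bicategory.whisker_exchange (B := BasedCategory.{u, u} B) η θ
  pentagon F G H I := Bicategory.pentagon (B := BasedCategory.{u, u} B)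
    F.toBased G.toBased H.toBased I.toBased
  triangle F G := Bicategory.triangle (B := BasedCategory.{u, u} B) F.toBased G.toBased

instance : Bicategory.Strict (Fib.{u} B) where

open Functor CatOpfibration

/-- The restriction `p_b : A_b ⥤ C_b` of a 1-cell `p` of `Fib(B)` to the fibres over `b`. -/
def fibreMap {A C : Fib.{u} B} (p : A ⟶ C) (b : B) :
    A.based.p.Fiber b ⥤ C.based.p.Fiber b where
  obj a := ⟨p.toBased.obj a.1, (p.toBased.w_obj a.1).trans a.2⟩
  map φ := ⟨p.toBased.map φ.1, by
    have := φ.2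
    infer_instance⟩
  map_id a := Subtype.ext (p.toBased.map_id a.1)
  map_comp φ ψ := Subtype.ext (p.toBased.map_comp φ.1 ψ.1)

/-- A 1-cell of `Fib(B)` is a fibrewise opfibration: its restriction to the fibres over each object
of `B` is an opfibration. -/
def IsFibrewiseOpfibration {A C : Fib.{u} B} (p : A ⟶ C) : Prop :=
  ∀ b : B, IsOpfibration (fibreMap p b)

/-- A 1-cell of `Fib(B)` is a fibrewise opfibration in groupoids: its restriction to the fibres over
each object of `B` is an opfibration in groupoids. -/
def IsFibrewiseOpfibrationInGroupoids {A C : Fib.{u} B} (p : A ⟶ C) : Prop :=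
  ∀ b : B, IsOpfibrationInGroupoids (fibreMap p b)

end Fib

/-!
Let `W` be the class of the morphisms of `A` that `p` sends to identities. The identee of `p` is the
full subcategory of the category of arrows of `A` on the morphisms in `W` (`Fib.isIdentee`), so its
coinverter is to be the localization `q : A ⥤ A[W⁻¹]`, with the functor `s : A[W⁻¹] ⥤ C` induced by
`p`. As 1-cells preserve the cleavages strictly, `W` is stable under reindexing along the chosen
lifts (`Fib.isStable_identityArrows`); hence reindexing extends to `A[W⁻¹]`, `q` preserves cartesian
morphisms (`CategoryTheory.Localization.isStronglyCartesian_Q_map`), the images of the chosen lifts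
are a cleavage of `A[W⁻¹]`, and the universal properties of the localization become those of the
coinverter (`Fib.isCoinverter`). All this holds for an arbitrary 1-cell `p`.

Suppose now that vertical morphisms out of the image of `p` have opcartesian lifts
(`Fib.HasVerticalPushforwards`). An object `x` of `A` with a morphism `i : p x ⟶ c`, for a fixed
object `c` of `C`, can be pushed forward along the vertical part of `i`. This is functorial in
`(x, i)`, inverts `W`, and therefore extends to the slice category of `A[W⁻¹]` over `c`
(`CategoryTheory.Localization.exists_pushforward`). Two facts follow: `s` is conservative
(`CategoryTheory.Localization.isIso_of_isIso_map`), and `q` sends opcartesian morphisms over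
vertical morphisms of `C` to opcartesian morphisms
(`CategoryTheory.Localization.isStronglyCocartesian_Q_map`). Both extensions, of reindexing and of
pushforwards, are instances of one principle: pulling back the coslice categories and the slice
categories of the base of a localization yields localizations again, because factorizations lift
uniquely along their projections to the base
(`CategoryTheory.Localization.exists_extension_along_elements`).

For a fibrewise opfibration, opcartesian morphisms of the fibres are opcartesian for `p`, since `p`
preserves cartesian morphisms (`Fib.isStronglyCocartesian_of_fibreMap`). So the assumption of the
previous paragraph holds, and the two facts restrict to the fibres.

For an internal opfibration, an opcartesian lift of the universal vertical 2-cell out of `p`, which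
lives on a comma object of `Fib(B)`, has opcartesian components
(`TwoCategory.IsInternalOpfibration.exists_pushforward`). So the assumption holds again, moreover
with a choice of pushforwards that preserves the cleavages strictly. Its image under `q` is such a
choice for `s`; since the comma objects of `s` and `p` have the same objects, it lifts the universal
vertical 2-cell out of `s`, and with it all 2-cells. By conservativity all vertical morphisms of
`A[W⁻¹]` are opcartesian for `s`, whence opcartesian 2-cells are stable under precomposition, and
the identee of `s` is invertible.
-/

/-! ### Extending families of objects from a category to its localization -/

namespace CategoryTheory.Localization

/-- A category over `S` with at most one morphism over a given `σ` between two given objects,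
presented by the types `carrier s` of its objects over `s` and the relations
`rel σ : carrier s → carrier t → Prop` (there is a morphism over `σ`), and along which
factorizations lift uniquely (`rel_factor`). The unique lifting of factorizations makes pulling
back along the projection to `S` compatible with localizations. -/
structure LiftingRelation (S : Type*) [Category S] where
  /-- the objects over an object of `S` -/
  carrier : S → Type*
  /-- the existence of a morphism over a morphism of `S` -/
  rel : ∀ {s t : S}, (s ⟶ t) → carrier s → carrier t → Prop
  rel_id : ∀ {s : S} {i j : carrier s}, rel (𝟙 s) i j ↔ i = j
  rel_comp : ∀ {s t r : S} {σ : s ⟶ t} {τ : t ⟶ r} {i : carrier s} {j : carrier t}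
    {k : carrier r}, rel σ i j → rel τ j k → rel (σ ≫ τ) i k
  rel_factor : ∀ {s t r : S} {σ : s ⟶ t} {τ : t ⟶ r} {i : carrier s} {k : carrier r},
    rel (σ ≫ τ) i k → ∃! j, rel σ i j ∧ rel τ j k

namespace LiftingRelation

/-- The coslice category under `r`, over `S`. -/
abbrev coyoneda {S : Type*} [Category S] (r : S) : LiftingRelation S where
  carrier s := r ⟶ s
  rel σ i j := i ≫ σ = j
  rel_id := by simp
  rel_comp := by rintro _ _ _ _ _ _ _ _ rfl rfl; simp
  rel_factor := by
    rintro _ _ _ σ _ i _ rfl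
    exact ⟨i ≫ σ, by simp, fun j hj => hj.1.symm⟩

/-- The slice category over `r`, over `S`. -/
abbrev yoneda {S : Type*} [Category S] (r : S) : LiftingRelation S where
  carrier s := s ⟶ r
  rel σ i j := i = σ ≫ j
  rel_id := by simp
  rel_comp := by rintro _ _ _ _ _ _ _ _ rfl rfl; simp
  rel_factor := by
    rintro _ _ _ _ τ _ k rfl
    exact ⟨τ ≫ k, by simp, fun j hj => hj.2⟩

variable {S : Type*} [Category S] (Ψ : LiftingRelation S) (D : Type*) [Category D]

/-- An object `s` of `S` with a family of objects of `D` indexed by the objects of `Ψ` over `s`.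
For `s : X ⥤ S`, functors `X ⥤ Ψ.Family D` over `S` amount to functors from the pullback of `Ψ`
along `s` to `D`. -/
structure Family where
  /-- the object of `S` -/
  base : S
  /-- the family of objects of `D` -/
  obj : Ψ.carrier base → D

variable {Ψ D}

/-- A morphism of families: a morphism `σ` of `S` and, for every morphism of `Ψ` over `σ`, a
morphism of `D`. -/
structure Family.Hom (X Y : Ψ.Family D) where
  /-- the morphism of `S` -/
  base : X.base ⟶ Y.base
  /-- the morphisms of `D` -/
  map : ∀ i j, Ψ.rel base i j → (X.obj i ⟶ Y.obj j)

theorem Family.Hom.ext' {X Y : Ψ.Family D} {f g : Family.Hom X Y} (h : f.base = g.base)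
    (h' : ∀ i j hf hg, f.map i j hf = g.map i j hg) : f = g := by
  obtain ⟨b, m⟩ := f
  obtain ⟨b', m'⟩ := g
  obtain rfl : b = b' := h
  obtain rfl : m = m' := by
    funext i j hij
    exact h' i j hij hij
  rfl

/-- The identity morphism of a family. -/
def Family.Hom.id (X : Ψ.Family D) : Family.Hom X X where
  base := 𝟙 _
  map _ _ h := eqToHom (by rw [Ψ.rel_id.1 h])

/-- The composite of two morphisms of families, in which a morphism of `Ψ` over `σ ≫ τ` is
factored into morphisms over `σ` and `τ`. -/
noncomputable def Family.Hom.comp {X Y Z : Ψ.Family D} (f : Family.Hom X Y)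
    (g : Family.Hom Y Z) : Family.Hom X Z where
  base := f.base ≫ g.base
  map i k h := f.map i _ (Ψ.rel_factor h).choose_spec.1.1 ≫
    g.map _ k (Ψ.rel_factor h).choose_spec.1.2

theorem Family.Hom.comp_map {X Y Z : Ψ.Family D} (f : Family.Hom X Y) (g : Family.Hom Y Z)
    {i j k} (hij : Ψ.rel f.base i j) (hjk : Ψ.rel g.base j k) (h) :
    (f.comp g).map i k h = f.map i j hij ≫ g.map j k hjk := by
  have e := (Ψ.rel_factor h).choose_spec.2 j ⟨hij, hjk⟩
  subst e
  rfl

noncomputable instance : Category (Ψ.Family D) where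
  Hom := Family.Hom
  id := Family.Hom.id
  comp := Family.Hom.comp
  id_comp f := by
    refine Family.Hom.ext' (Category.id_comp _) fun i j h h' => ?_
    rw [Family.Hom.comp_map _ _ (Ψ.rel_id.2 rfl) h']
    simp [Family.Hom.id]
  comp_id f := by
    refine Family.Hom.ext' (Category.comp_id _) fun i j h h' => ?_
    rw [Family.Hom.comp_map _ _ h' (Ψ.rel_id.2 rfl)]
    simp [Family.Hom.id]
  assoc f g h := by
    refine Family.Hom.ext' (Category.assoc _ _ _) fun i l hil hil' => ?_
    obtain ⟨j, ⟨hij, hjl⟩, -⟩ := Ψ.rel_factor hil'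
    obtain ⟨k, ⟨hjk, hkl⟩, -⟩ := Ψ.rel_factor hjl
    have hik : Ψ.rel (f.comp g).base i k := Ψ.rel_comp hij hjk
    rw [Family.Hom.comp_map _ _ hik hkl, Family.Hom.comp_map _ _ hij hjk,
      Family.Hom.comp_map _ _ hij hjl, Family.Hom.comp_map _ _ hjk hkl, Category.assoc]

theorem Family.comp_map {X Y Z : Ψ.Family D} (f : X ⟶ Y) (g : Y ⟶ Z)
    {i j k} (hij : Ψ.rel f.base i j) (hjk : Ψ.rel g.base j k) (h) :
    (f ≫ g).map i k h = f.map i j hij ≫ g.map j k hjk :=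
  Family.Hom.comp_map f g hij hjk h

theorem Family.id_map (X : Ψ.Family D) (i) (h) : (𝟙 X : X ⟶ X).map i i h = 𝟙 _ := rfl

/-- The projection of the category of families to `S`. -/
def Family.forget : Ψ.Family D ⥤ S where
  obj X := X.base
  map f := f.base
  map_id _ := rfl
  map_comp _ _ := rfl

theorem rel_of_isIso {s t : S} {σ : s ⟶ t} {τ : t ⟶ s} (h : σ ≫ τ = 𝟙 _) (h' : τ ≫ σ = 𝟙 _)
    {i j} (hij : Ψ.rel τ j i) : Ψ.rel σ i j := by
  have hj : Ψ.rel (τ ≫ σ) j j := by rw [h']; exact Ψ.rel_id.2 rfl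
  obtain ⟨k, ⟨hk, hk'⟩, -⟩ := Ψ.rel_factor hj
  have : k = i := by
    have h3 := Ψ.rel_comp hk' hij
    rw [h] at h3
    exact Ψ.rel_id.1 h3
  rwa [← this]

theorem Family.isIso {X Y : Ψ.Family D} (f : X ⟶ Y) (hb : IsIso f.base)
    (h : ∀ i j (hij : Ψ.rel f.base i j), IsIso (f.map i j hij)) : IsIso f := by
  have key : ∀ {j i}, Ψ.rel (inv f.base) j i → Ψ.rel f.base i j := fun h =>
    Ψ.rel_of_isIso (by simp) (by simp) h
  have key' : ∀ {j i}, Ψ.rel f.base i j → Ψ.rel (inv f.base) j i := fun h =>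
    Ψ.rel_of_isIso (by simp) (by simp) h
  let g : Y ⟶ X :=
    { base := inv f.base
      map := fun j i hji => inv (f.map i j (key hji)) }
  refine ⟨g, Family.Hom.ext' (IsIso.hom_inv_id f.base) fun i k hik hik' => ?_,
    Family.Hom.ext' (IsIso.inv_hom_id f.base) fun j k hik hik' => ?_⟩
  · obtain rfl := Ψ.rel_id.1 hik'
    obtain ⟨j, ⟨hij, hjk⟩, -⟩ := Ψ.rel_factor hik
    rw [Family.comp_map _ _ hij hjk, Family.id_map]
    exact IsIso.hom_inv_id _
  · obtain rfl := Ψ.rel_id.1 hik'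
    obtain ⟨i, ⟨hij, hjk⟩, -⟩ := Ψ.rel_factor hik
    rw [Family.comp_map _ _ hij hjk, Family.id_map]
    exact IsIso.inv_hom_id _

end LiftingRelation

variable {A : Type*} [Category A] {W : MorphismProperty A} {S D : Type*} [Category S] [Category D]

/-- The pullback of `Ψ` along `s : W.Localization ⥤ S` is a localization of its pullback along
`W.Q ⋙ s`: functorial data indexed by the objects `(x, i)` of the latter, invertible on `W`,
extend to the morphisms of the former. -/
theorem exists_extension_along_elements (s : W.Localization ⥤ S) (Ψ : LiftingRelation S)
    (obj : ∀ x : A, Ψ.carrier (s.obj (W.Q.obj x)) → D)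
    (map : ∀ {x y : A} (u : x ⟶ y) (i j), Ψ.rel (s.map (W.Q.map u)) i j → (obj x i ⟶ obj y j))
    (map_id : ∀ (x : A) (i h), map (𝟙 x) i i h = 𝟙 _)
    (map_comp : ∀ {x y z : A} (u : x ⟶ y) (v : y ⟶ z) (i j k hij hjk hik),
      map (u ≫ v) i k hik = map u i j hij ≫ map v j k hjk)
    (isIso_map : ∀ {x y : A} (u : x ⟶ y), W u → ∀ i j h, IsIso (map u i j h)) :
    ∃ ext : ∀ {x y : A} (m : W.Q.obj x ⟶ W.Q.obj y) (i j), Ψ.rel (s.map m) i j →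
        (obj x i ⟶ obj y j),
      (∀ {x y : A} (u : x ⟶ y) (i j h), ext (W.Q.map u) i j h = map u i j h) ∧
      (∀ {x y z : A} (m : W.Q.obj x ⟶ W.Q.obj y) (n : W.Q.obj y ⟶ W.Q.obj z) (i j k hij hjk hik),
        ext (m ≫ n) i k hik = ext m i j hij ≫ ext n j k hjk) ∧
      (∀ {x y : A} (e : W.Q.obj x ≅ W.Q.obj y) (i j h h'),
        ext e.hom i j h ≫ ext e.inv j i h' = 𝟙 _) := by
  let G : A ⥤ Ψ.Family D :=
    { obj := fun x => ⟨s.obj (W.Q.obj x), obj x⟩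
      map := fun u => ⟨s.map (W.Q.map u), map u⟩
      map_id := fun x => by
        refine LiftingRelation.Family.Hom.ext' ?_ fun i j hf hg => ?_
        · exact (congrArg s.map (W.Q.map_id x)).trans (s.map_id _)
        · obtain rfl := Ψ.rel_id.1 hg
          exact map_id x i _
      map_comp := fun u v => by
        refine LiftingRelation.Family.Hom.ext' ?_ fun i k hf hg => ?_
        · exact (congrArg s.map (W.Q.map_comp u v)).trans (s.map_comp _ _)
        · obtain ⟨j, ⟨hij, hjk⟩, -⟩ := Ψ.rel_factor hg
          refine (map_comp u v i j k hij hjk hf).trans ?_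
          exact (LiftingRelation.Family.Hom.comp_map _ _ hij hjk hg).symm }
  have hG : W.IsInvertedBy G := fun x y w hw => by
    have := W.Q_inverts w hw
    exact LiftingRelation.Family.isIso _ (inferInstanceAs (IsIso (s.map (W.Q.map w))))
      (isIso_map w hw)
  let N := Construction.lift G hG
  have hN : N ⋙ LiftingRelation.Family.forget = s := by
    apply Construction.uniq
    rw [← Functor.assoc, Construction.fac]
    rfl
  have hb : ∀ {x y : A} (m : W.Q.obj x ⟶ W.Q.obj y), (N.map m).base = s.map m := fun m => by
    exact (Functor.congr_hom hN m).trans ((Category.id_comp _).trans (Category.comp_id _))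
  have hQ : ∀ {x y : A} (u : x ⟶ y), N.map (W.Q.map u) = G.map u := fun u => by
    exact (Functor.congr_hom (Construction.fac G hG) u).trans
      ((Category.id_comp _).trans (Category.comp_id _))
  refine ⟨fun m i j h => (N.map m).map i j ((hb m).symm ▸ h), fun u i j h => ?_,
    fun m n i j k hij hjk hik => ?_, fun {x y} e i j h h' => ?_⟩
  · have : ∀ (f : G.obj _ ⟶ G.obj _) (hf : f = G.map u) (h'), f.map i j h' = map u i j h := by
      rintro _ rfl _; rfl
    exact this _ (hQ u) _
  · have : ∀ (f : N.obj _ ⟶ N.obj _) (hf : f = N.map m ≫ N.map n) (h'), f.map i k h' =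
      (N.map m).map i j ((hb m).symm ▸ hij) ≫ (N.map n).map j k ((hb n).symm ▸ hjk) := by
      rintro _ rfl _
      exact LiftingRelation.Family.comp_map _ _ _ _ _
    exact this _ (N.map_comp m n) _
  · have hii : Ψ.rel (N.map e.hom ≫ N.map e.inv).base i i :=
      Ψ.rel_comp ((hb e.hom).symm ▸ h) ((hb e.inv).symm ▸ h')
    refine (LiftingRelation.Family.comp_map (N.map e.hom) (N.map e.inv) _ _ hii).symm.trans ?_
    have : ∀ (f : N.obj (W.Q.obj x) ⟶ N.obj (W.Q.obj x)) (hf : f = 𝟙 _) (h'),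
        f.map i i h' = 𝟙 _ := by
      rintro _ rfl _; rfl
    exact this _ (by rw [← N.map_comp, e.hom_inv_id, N.map_id]) _

theorem rel_symm_of_iso (s : W.Localization ⥤ S) (Ψ : LiftingRelation S) {X Y : W.Localization}
    (e : X ≅ Y) {i j} (h : Ψ.rel (s.map e.inv) j i) : Ψ.rel (s.map e.hom) i j :=
  Ψ.rel_of_isIso (by simp [← s.map_comp]) (by simp [← s.map_comp]) h

/-- Induction on the morphisms of a localization: a property of morphisms that holds for the images
of the morphisms of `A` and is stable under composition and inverses holds for all of them. -/
theorem Q_hom_induction {P : ∀ {x y : A}, (W.Q.obj x ⟶ W.Q.obj y) → Prop}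
    (comp : ∀ {x y z : A} (m : W.Q.obj x ⟶ W.Q.obj y) (n : W.Q.obj y ⟶ W.Q.obj z),
      P m → P n → P (m ≫ n))
    (of : ∀ {x y : A} (u : x ⟶ y), P (W.Q.map u))
    (inv : ∀ {x y : A} (e : W.Q.obj x ≅ W.Q.obj y), P e.hom → P e.inv)
    {x y : A} (m : W.Q.obj x ⟶ W.Q.obj y) : P m := by
  let P' : MorphismProperty W.Localization := fun X Y m =>
    P (x := (Construction.objEquiv W).symm X) (y := (Construction.objEquiv W).symm Y) m
  have : P'.IsStableUnderComposition := ⟨fun m n hm hn => comp _ _ hm hn⟩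
  have hP : P' = ⊤ := Construction.morphismProperty_eq_top' P' (fun x y u => of u)
    (fun X Y e he => inv (x := (Construction.objEquiv W).symm X)
      (y := (Construction.objEquiv W).symm Y) e he)
  have h : P' m := by rw [hP]; exact MorphismProperty.top_apply m
  exact h

theorem Q_obj_surjective (W : MorphismProperty A) : Function.Surjective W.Q.obj :=
  (Construction.objEquiv W).surjective

end CategoryTheory.Localization

/-! ### Localization at a class of vertical morphisms stable under reindexing -/

namespace Cleavage

open CategoryTheory.Functor

variable {B X : Type*} [Category B] [Category X] {p : X ⥤ B} (c : Cleavage p)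

/-- The vertical morphism between the domains of the chosen lifts of `β` at `x` and of `β ≫ σ` at
`y` induced by a morphism `u : x ⟶ y` over `σ`. -/
noncomputable def map {R S S' : B} (β : R ⟶ S) (β' : R ⟶ S') {x y : X} (hx : p.obj x = S)
    (hy : p.obj y = S') (u : x ⟶ y) {σ : S ⟶ S'} (hu : p.IsHomLift σ u) (h : β ≫ σ = β') :
    c.dom β x hx ⟶ c.dom β' y hy :=
  haveI := c.isStronglyCartesian β x hx
  haveI := c.isStronglyCartesian β' y hy
  haveI : p.IsHomLift (β ≫ σ) (c.lift β x hx ≫ u) := inferInstance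
  IsStronglyCartesian.map p β' (c.lift β' y hy) (g := 𝟙 R) (h.trans (Category.id_comp _).symm)
    (c.lift β x hx ≫ u)

section

variable {R S S' : B} (β : R ⟶ S) (β' : R ⟶ S') {x y : X} (hx : p.obj x = S)
    (hy : p.obj y = S') (u : x ⟶ y) {σ : S ⟶ S'} (hu : p.IsHomLift σ u) (h : β ≫ σ = β')

instance map_isHomLift : p.IsHomLift (𝟙 R) (c.map β β' hx hy u hu h) := by
  have := c.isStronglyCartesian β x hx
  have := c.isStronglyCartesian β' y hy
  unfold map
  infer_instance

theorem map_lift : c.map β β' hx hy u hu h ≫ c.lift β' y hy = c.lift β x hx ≫ u := by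
  have := c.isStronglyCartesian β x hx
  have := c.isStronglyCartesian β' y hy
  have : p.IsHomLift (β ≫ σ) (c.lift β x hx ≫ u) := inferInstance
  exact IsStronglyCartesian.fac _ _ _ _ _

theorem hom_ext {R T : B} (γ : T ⟶ R) (β : R ⟶ S) {z : X} {v w : z ⟶ c.dom β x hx}
    (hv : p.IsHomLift γ v) (hw : p.IsHomLift γ w)
    (e : v ≫ c.lift β x hx = w ≫ c.lift β x hx) : v = w := by
  have := c.isStronglyCartesian β x hx
  exact IsStronglyCartesian.ext p β _ γ e

theorem map_id {σ : S ⟶ S} (hid : p.IsHomLift σ (𝟙 x)) (h' : β ≫ σ = β) :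
    c.map β β hx hx (𝟙 x) hid h' = 𝟙 _ := by
  have := c.isStronglyCartesian β x hx
  refine c.hom_ext hx (𝟙 R) β inferInstance
    (IsHomLift.id (IsHomLift.domain_eq p β (c.lift β x hx))) ?_
  simp [map_lift]

theorem map_comp {S'' : B} {z : X} (hz : p.obj z = S'') {β'' : R ⟶ S''} (v : y ⟶ z)
    {τ : S' ⟶ S''} (hv : p.IsHomLift τ v) (h' : β' ≫ τ = β'')
    {ρ : S ⟶ S''} (huv : p.IsHomLift ρ (u ≫ v)) (h'' : β ≫ ρ = β'') :
    c.map β β'' hx hz (u ≫ v) huv h'' =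
      c.map β β' hx hy u hu h ≫ c.map β' β'' hy hz v hv h' := by
  refine c.hom_ext hz (𝟙 R) β'' inferInstance inferInstance ?_
  rw [map_lift, Category.assoc, map_lift, ← Category.assoc, ← Category.assoc, map_lift]

theorem isIso_map (hu' : p.IsStronglyCartesian σ u) : IsIso (c.map β β' hx hy u hu h) := by
  have := c.isStronglyCartesian β x hx
  have := c.isStronglyCartesian β' y hy
  subst h
  have h1 : p.IsStronglyCartesian (𝟙 R ≫ β ≫ σ)
      (c.map β (β ≫ σ) hx hy u hu rfl ≫ c.lift (β ≫ σ) y hy) := by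
    rw [map_lift, Category.id_comp]
    infer_instance
  have := IsStronglyCartesian.of_comp p (f := 𝟙 R) (g := β ≫ σ)
    (φ := c.map β (β ≫ σ) hx hy u hu rfl) (ψ := c.lift (β ≫ σ) y hy)
  exact IsStronglyCartesian.isIso_of_base_isIso p (𝟙 R) _

theorem isIso_lift [IsIso β] : IsIso (c.lift β x hx) := by
  have := c.isStronglyCartesian β x hx
  exact IsStronglyCartesian.isIso_of_base_isIso p β _

end

/-- A class of morphisms that are vertical and stable under reindexing along the chosen lifts. -/
structure IsStable (W : MorphismProperty X) : Prop where
  vertical : ∀ {x y : X} (w : x ⟶ y), W w → p.IsHomLift (𝟙 (p.obj x)) w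
  map_mem : ∀ {R S S' : B} (β : R ⟶ S) (β' : R ⟶ S') {x y : X} (hx : p.obj x = S)
    (hy : p.obj y = S') (w : x ⟶ y) {σ : S ⟶ S'} (hw : p.IsHomLift σ w) (h : β ≫ σ = β'), W w →
      W (c.map β β' hx hy w hw h)

namespace IsStable

variable {c} {W : MorphismProperty X}

theorem inverts (hW : c.IsStable W) : W.IsInvertedBy p := fun x y w hw => by
  have := hW.vertical w hw
  rw [IsHomLift.fac' p (𝟙 (p.obj x)) w]
  infer_instance

end IsStable

end Cleavage

namespace CategoryTheory.Localization

open CategoryTheory.Functor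

variable {B X : Type*} [Category B] [Category X] {p : X ⥤ B} {W : MorphismProperty X}
  {s : W.Localization ⥤ B}

theorem over_obj (hs : W.Q ⋙ s = p) (x : X) : p.obj x = s.obj (W.Q.obj x) := by
  subst hs; rfl

theorem over_map (hs : W.Q ⋙ s = p) {x y : X} (u : x ⟶ y) :
    p.IsHomLift (s.map (W.Q.map u)) u := by
  subst hs
  exact IsHomLift.map _ u

theorem isHomLift_Q_map (hs : W.Q ⋙ s = p) {x y : X} {u : x ⟶ y} {R S : B} {β : R ⟶ S}
    (hu : p.IsHomLift β u) : s.IsHomLift β (W.Q.map u) := by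
  subst hs
  subst_hom_lift (W.Q ⋙ s) β u
  exact IsHomLift.map _ (W.Q.map u)

/-- Reindexing extends to the localization at a stable class: for `i : R ⟶ s x`, the object
`c.dom i x` depends functorially on the object `(x, i)` of the coslice category of `W.Localization`
under `R`, and the images of the chosen lifts are natural in `(x, i)`. -/
theorem exists_reindexing {c : Cleavage p} (hW : c.IsStable W) (hs : W.Q ⋙ s = p) (R : B) :
    ∃ ext : ∀ {x y : X} (m : W.Q.obj x ⟶ W.Q.obj y) (i : R ⟶ s.obj (W.Q.obj x))
      (j : R ⟶ s.obj (W.Q.obj y)), i ≫ s.map m = j →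
        (W.Q.obj (c.dom i x (over_obj hs x)) ⟶ W.Q.obj (c.dom j y (over_obj hs y))),
      (∀ {x y : X} (u : x ⟶ y) (i j h), ext (W.Q.map u) i j h =
        W.Q.map (c.map i j (over_obj hs x) (over_obj hs y) u (over_map hs u) h)) ∧
      (∀ {x y z : X} (m : W.Q.obj x ⟶ W.Q.obj y) (n : W.Q.obj y ⟶ W.Q.obj z) (i j k hij hjk hik),
        ext (m ≫ n) i k hik = ext m i j hij ≫ ext n j k hjk) ∧
      (∀ {x y : X} (m : W.Q.obj x ⟶ W.Q.obj y) (i j h),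
        ext m i j h ≫ W.Q.map (c.lift j y (over_obj hs y)) =
          W.Q.map (c.lift i x (over_obj hs x)) ≫ m) ∧
      (∀ {x y : X} (m : W.Q.obj x ⟶ W.Q.obj y) (i j h), s.IsHomLift (𝟙 R) (ext m i j h)) := by
  obtain ⟨ext, h1, h2, h4⟩ := exists_extension_along_elements s
    (LiftingRelation.coyoneda R) (fun x i => W.Q.obj (c.dom i x (over_obj hs x)))
    (fun {x y} u i j h =>
      W.Q.map (c.map i j (over_obj hs x) (over_obj hs y) u (over_map hs u) h))
    (fun x i h => by
      rw [c.map_id i (over_obj hs x), W.Q.map_id])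
    (fun u v i j k hij hjk hik => by
      rw [← W.Q.map_comp, ← c.map_comp])
    (fun {x y} u hu i j h => W.Q_inverts _ (hW.map_mem _ _ _ _ _ _ _ hu))
  refine ⟨ext, h1, h2, fun m => ?_, fun m => ?_⟩
  · refine Q_hom_induction (P := fun {x y} m => ∀ (i : R ⟶ s.obj (W.Q.obj x)) j h, ext m i j h ≫
      W.Q.map (c.lift j y (over_obj hs y)) = W.Q.map (c.lift i x (over_obj hs x)) ≫ m)
      (fun m n hm hn i k hik => ?_) (fun u i j h => ?_) (fun e he j i h => ?_) m
    · have hik' : (i ≫ s.map m) ≫ s.map n = k := by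
        rw [← hik, s.map_comp, Category.assoc]
      rw [h2 m n i _ k rfl hik' hik, Category.assoc, hn, ← Category.assoc, hm, Category.assoc]
    · rw [h1, ← W.Q.map_comp, c.map_lift, W.Q.map_comp]
    · have hij : i ≫ s.map e.hom = j := rel_symm_of_iso s (LiftingRelation.coyoneda R) e h
      have e1 := he i j hij
      have e2 : ext e.inv j i h ≫ ext e.hom i j hij = 𝟙 _ := h4 e.symm j i h hij
      rw [← cancel_mono e.hom, Category.assoc, ← e1, reassoc_of% e2]
      simp
  · refine Q_hom_induction (P := fun {x y} m => ∀ (i : R ⟶ s.obj (W.Q.obj x)) j h,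
      s.IsHomLift (𝟙 R) (ext m i j h))
      (fun m n hm hn i k hik => ?_) (fun u i j h => ?_) (fun e he j i h => ?_) m
    · have hik' : (i ≫ s.map m) ≫ s.map n = k := by
        rw [← hik, s.map_comp, Category.assoc]
      rw [h2 m n i _ k rfl hik' hik]
      have := hm i _ rfl
      have := hn _ _ hik'
      infer_instance
    · rw [h1]
      exact isHomLift_Q_map hs inferInstance
    · have hij : i ≫ s.map e.hom = j := rel_symm_of_iso s (LiftingRelation.coyoneda R) e h
      have := he i j hij
      exact IsHomLift.lift_id_inv s R
        ⟨ext e.hom i j hij, ext e.inv j i h, h4 e i j hij h, h4 e.symm j i h hij⟩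

/-- The localization functor at a stable class of vertical morphisms preserves cartesian
morphisms. -/
theorem isStronglyCartesian_Q_map {c : Cleavage p} (hW : c.IsStable W) (hs : W.Q ⋙ s = p)
    {R S : B} {β : R ⟶ S} {a b : X} {l : a ⟶ b} (hl : p.IsStronglyCartesian β l) :
    s.IsStronglyCartesian β (W.Q.map l) := by
  have hl' : s.IsHomLift β (W.Q.map l) := isHomLift_Q_map hs inferInstance
  obtain rfl : s.obj (W.Q.obj a) = R := IsHomLift.domain_eq s β (W.Q.map l)
  obtain rfl : s.obj (W.Q.obj b) = S := IsHomLift.codomain_eq s β (W.Q.map l)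
  obtain rfl : β = s.map (W.Q.map l) := IsHomLift.eq_of_isHomLift s β _
  refine { universal_property' := fun {y'} g φ hφ => ?_ }
  obtain ⟨y, rfl⟩ := Q_obj_surjective W y'
  obtain ⟨ext, h1, h2, h3, h4⟩ := exists_reindexing hW hs (s.obj (W.Q.obj y))
  -- the chosen lift of the identity at `y`
  have : p.IsStronglyCartesian (𝟙 _) (c.lift (𝟙 (s.obj (W.Q.obj y))) y (over_obj hs y)) :=
    c.isStronglyCartesian _ _ _
  have hε : IsIso (c.lift (𝟙 (s.obj (W.Q.obj y))) y (over_obj hs y)) :=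
    c.isIso_lift _ _
  have hη := c.isIso_map g _ (over_obj hs a) (over_obj hs b) l (over_map hs l) rfl hl
  have hη' := h1 l g _ rfl
  have hφ' : s.map φ = g ≫ s.map (W.Q.map l) := (IsHomLift.eq_of_isHomLift s _ φ).symm
  -- the factorization of `φ` is its reindexing, transported along the comparisons with the chosen
  -- lifts of the identity and of `g`
  refine ⟨inv (W.Q.map (c.lift (𝟙 (s.obj (W.Q.obj y))) y (over_obj hs y))) ≫
    ext φ (𝟙 _) (g ≫ s.map (W.Q.map l)) (by rw [hφ', Category.id_comp]) ≫
      inv (W.Q.map (c.map g _ (over_obj hs a) (over_obj hs b) l (over_map hs l) rfl)) ≫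
        W.Q.map (c.lift g a (over_obj hs a)), ⟨?_, ?_⟩, fun m hm => ?_⟩
  · have := h4 φ (𝟙 _) (g ≫ s.map (W.Q.map l)) (by rw [hφ', Category.id_comp])
    have : p.IsHomLift (𝟙 (s.obj (W.Q.obj y))) (c.map g _ (over_obj hs a) (over_obj hs b) l
      (over_map hs l) rfl) := inferInstance
    have := isHomLift_Q_map hs this
    have : p.IsStronglyCartesian g (c.lift g a (over_obj hs a)) := c.isStronglyCartesian _ _ _
    have : s.IsHomLift g (W.Q.map (c.lift g a (over_obj hs a))) :=
      isHomLift_Q_map hs inferInstance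
    have : s.IsHomLift (𝟙 (s.obj (W.Q.obj y)))
        (W.Q.map (c.lift (𝟙 (s.obj (W.Q.obj y))) y (over_obj hs y))) :=
      isHomLift_Q_map hs inferInstance
    infer_instance
  · simp only [Category.assoc]
    rw [IsIso.inv_comp_eq, ← W.Q.map_comp, ← c.map_lift g _ (over_obj hs a) (over_obj hs b) l
      (over_map hs l) rfl, W.Q.map_comp, IsIso.inv_hom_id_assoc, h3]
  · obtain ⟨hm, rfl⟩ := hm
    have hgm : g = s.map m := IsHomLift.eq_of_isHomLift s g m
    subst hgm
    rw [h2 m (W.Q.map l) _ (s.map m) _ (by simp) rfl, h1, Category.assoc, IsIso.hom_inv_id_assoc,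
      h3, IsIso.inv_hom_id_assoc]

end CategoryTheory.Localization

/-! ### Factorization into a vertical and a cartesian morphism -/

namespace Cleavage

open CategoryTheory.Functor

variable {B C : Type*} [Category B] [Category C] {g : C ⥤ B} (c : Cleavage g)

/-- The vertical part `i'` of a morphism `i`, in the factorization `i = i' ≫ l` with `l` the chosen
lift of the image of `i`. -/
noncomputable def verticalPart {d e : C} (i : d ⟶ e) : d ⟶ c.dom (g.map i) e rfl :=
  haveI := c.isStronglyCartesian (g.map i) e rfl
  IsStronglyCartesian.map g (g.map i) (c.lift (g.map i) e rfl) (Category.id_comp _).symm i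

/-- The morphism between the domains of the cartesian parts of `i` and `j` induced by a
factorization `i = υ ≫ j`. It is cartesian, since both cartesian parts are. -/
noncomputable def cartesianPartMap {d d' e : C} (υ : d ⟶ d') (i : d ⟶ e) (j : d' ⟶ e)
    (h : i = υ ≫ j) : c.dom (g.map i) e rfl ⟶ c.dom (g.map j) e rfl :=
  haveI := c.isStronglyCartesian (g.map i) e rfl
  haveI := c.isStronglyCartesian (g.map j) e rfl
  IsStronglyCartesian.map g (g.map j) (c.lift (g.map j) e rfl) (g := g.map υ)
    ((congrArg g.map h).trans (g.map_comp _ _)) (c.lift (g.map i) e rfl)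

section

variable {d d' d'' e : C} (υ : d ⟶ d') (τ : d' ⟶ d'') (i : d ⟶ e) (j : d' ⟶ e) (k : d'' ⟶ e)
  (h : i = υ ≫ j) (h' : j = τ ≫ k)

instance : g.IsHomLift (𝟙 (g.obj d)) (c.verticalPart i) := by
  have := c.isStronglyCartesian (g.map i) e rfl
  unfold verticalPart
  infer_instance

instance : g.IsHomLift (g.map υ) (c.cartesianPartMap υ i j h) := by
  have := c.isStronglyCartesian (g.map i) e rfl
  have := c.isStronglyCartesian (g.map j) e rfl
  unfold cartesianPartMap
  infer_instance

theorem verticalPart_lift : c.verticalPart i ≫ c.lift (g.map i) e rfl = i := by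
  have := c.isStronglyCartesian (g.map i) e rfl
  exact IsStronglyCartesian.fac _ _ _ _ _

theorem cartesianPartMap_lift :
    c.cartesianPartMap υ i j h ≫ c.lift (g.map j) e rfl = c.lift (g.map i) e rfl := by
  have := c.isStronglyCartesian (g.map i) e rfl
  have := c.isStronglyCartesian (g.map j) e rfl
  exact IsStronglyCartesian.fac _ _ _ _ _

theorem verticalPart_cartesianPartMap :
    c.verticalPart i ≫ c.cartesianPartMap υ i j h = υ ≫ c.verticalPart j := by
  refine c.hom_ext rfl (g.map υ) (g.map j) ?_ ?_ ?_
  · infer_instance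
  · infer_instance
  · simp [verticalPart_lift, cartesianPartMap_lift, h]

instance : g.IsStronglyCartesian (g.map υ) (c.cartesianPartMap υ i j h) := by
  have := c.isStronglyCartesian (g.map j) e rfl
  have : g.IsStronglyCartesian (g.map υ ≫ g.map j)
      (c.cartesianPartMap υ i j h ≫ c.lift (g.map j) e rfl) := by
    rw [cartesianPartMap_lift, ← g.map_comp, ← h]
    exact c.isStronglyCartesian _ _ _
  exact IsStronglyCartesian.of_comp g (g := g.map j) (ψ := c.lift (g.map j) e rfl)

theorem cartesianPartMap_id {υ : d ⟶ d} (hυ : υ = 𝟙 d) (h : i = υ ≫ i) :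
    c.cartesianPartMap υ i i h = 𝟙 _ := by
  subst hυ
  have := c.isStronglyCartesian (g.map i) e rfl
  refine c.hom_ext rfl (𝟙 _) (g.map i) ?_ ?_ ?_
  · rw [← g.map_id]; infer_instance
  · exact IsHomLift.id (IsHomLift.domain_eq g (g.map i) (c.lift (g.map i) e rfl))
  · simp [cartesianPartMap_lift]

theorem cartesianPartMap_comp (h'' : i = (υ ≫ τ) ≫ k) :
    c.cartesianPartMap (υ ≫ τ) i k h'' =
      c.cartesianPartMap υ i j h ≫ c.cartesianPartMap τ j k h' := by
  refine c.hom_ext rfl (g.map (υ ≫ τ)) (g.map k) ?_ ?_ ?_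
  · infer_instance
  · rw [g.map_comp]; infer_instance
  · simp [cartesianPartMap_lift]

theorem isIso_verticalPart (hi : IsIso i) : IsIso (c.verticalPart i) := by
  have := c.isIso_lift (g.map i) (rfl : g.obj e = g.obj e)
  have h := c.verticalPart_lift i
  rw [← IsIso.eq_comp_inv] at h
  rw [h]
  infer_instance

theorem cartesianPartMap_eqToHom (hd : d = d') (h : i = eqToHom hd ≫ j) :
    ∃ h', c.cartesianPartMap (eqToHom hd) i j h = eqToHom h' := by
  subst hd
  obtain rfl : i = j := by simpa using h
  exact ⟨rfl, c.cartesianPartMap_id _ rfl _⟩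

end

end Cleavage

/-! ### Lifts of morphisms and composite functors -/

namespace CategoryTheory.Functor

variable {A B C : Type*} [Category A] [Category B] [Category C]

theorem IsStronglyCartesian.self {p : A ⥤ B} {R S : B} {β : R ⟶ S} {a b : A} {φ : a ⟶ b}
    (h : p.IsStronglyCartesian β φ) : p.IsStronglyCartesian (p.map φ) φ := by
  subst_hom_lift p β φ
  exact h

theorem isHomLift_comp_iff (F : A ⥤ C) (g : C ⥤ B) {R S : B} {β : R ⟶ S} {a b : A} {φ : a ⟶ b} :
    (F ⋙ g).IsHomLift β φ ↔ g.IsHomLift β (F.map φ) := by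
  constructor
  · intro h
    subst_hom_lift (F ⋙ g) β φ
    exact .map (F.map φ)
  · intro h
    subst_hom_lift g β (F.map φ)
    exact .map φ

theorem IsHomLift.eq_map {p : A ⥤ B} {a b : A} {f : p.obj a ⟶ p.obj b} {φ : a ⟶ b}
    (h : p.IsHomLift f φ) : f = p.map φ := IsHomLift.eq_of_isHomLift p f φ

theorem IsHomLift.obj_codomain {p : A ⥤ B} {R S : B} {a b : A} {f : R ⟶ S} {φ : a ⟶ b}
    (h : p.IsHomLift f φ) : p.obj b = S := IsHomLift.codomain_eq p f φ

theorem IsHomLift.obj_domain {p : A ⥤ B} {R S : B} {a b : A} {f : R ⟶ S} {φ : a ⟶ b}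
    (h : p.IsHomLift f φ) : p.obj a = R := IsHomLift.domain_eq p f φ

theorem IsHomLift.map_eq {p : A ⥤ B} {R S : B} {a b : A} {f : R ⟶ S} {φ : a ⟶ b}
    (h : p.IsHomLift f φ) : p.map φ = eqToHom h.obj_domain ≫ f ≫ eqToHom h.obj_codomain.symm :=
  IsHomLift.fac' p f φ

theorem IsHomLift.map_eq_eqToHom {p : A ⥤ B} {R S : B} {e : R = S} {a b : A} {φ : a ⟶ b}
    (h : p.IsHomLift (eqToHom e) φ) :
    p.map φ = eqToHom (h.obj_domain.trans (e.trans h.obj_codomain.symm)) := by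
  rw [h.map_eq]
  simp

theorem IsHomLift.comp_right {F : A ⥤ C} {g : C ⥤ B} {d e : C} {γ : d ⟶ e} {a b : A} {φ : a ⟶ b}
    (h : F.IsHomLift γ φ) : (F ⋙ g).IsHomLift (g.map γ) φ := by
  subst_hom_lift F γ φ
  exact .map φ

theorem IsHomLift.comp_right_iff {F : A ⥤ C} {g : C ⥤ B} {d e : C} {γ : d ⟶ e} {a b : A}
    {φ : a ⟶ b} (h : F.IsHomLift γ φ) {R S : B} {β : R ⟶ S} :
    (F ⋙ g).IsHomLift β φ ↔ g.IsHomLift β γ := by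
  subst_hom_lift F γ φ
  exact isHomLift_comp_iff F g

theorem IsHomLift.isIso_map_iff {p : A ⥤ B} {R S : B} {β : R ⟶ S} {a b : A} {φ : a ⟶ b}
    (h : p.IsHomLift β φ) : IsIso (p.map φ) ↔ IsIso β := by
  subst_hom_lift p β φ
  rfl

theorem IsHomLift.isStronglyCartesian_map {F : A ⥤ C} {g : C ⥤ B} {d e : C} {γ : d ⟶ e} {a b : A}
    {φ : a ⟶ b} (h : F.IsHomLift γ φ) {R S : B} {β : R ⟶ S} (hγ : g.IsStronglyCartesian β γ) :
    g.IsStronglyCartesian β (F.map φ) := by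
  subst_hom_lift F γ φ
  exact hγ

theorem IsHomLift.id_of_eqToHom {p : A ⥤ B} {R S : B} {h : R = S} {a b : A} {φ : a ⟶ b}
    (hφ : p.IsHomLift (eqToHom h) φ) : p.IsHomLift (𝟙 (p.obj a)) φ := by
  subst h
  obtain rfl := IsHomLift.domain_eq p (eqToHom (rfl : R = R)) φ
  exact hφ

theorem IsHomLift.eq_eqToHom {p : A ⥤ B} {R S R' S' : B} {β : R ⟶ S} {a b : A} {φ : a ⟶ b}
    (h : p.IsHomLift β φ) {h' : R' = S'} (hφ : p.IsHomLift (eqToHom h') φ) :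
    ∃ h, β = eqToHom h := by
  subst_hom_lift p β φ
  subst h'
  rename_i x y φ
  exact ⟨(IsHomLift.domain_eq p (eqToHom (rfl : R' = R')) φ).trans
    (IsHomLift.codomain_eq p (eqToHom (rfl : R' = R')) φ).symm,
    (IsHomLift.fac' p (eqToHom (rfl : R' = R')) φ).trans (by simp)⟩

theorem IsStronglyCocartesian.congr_base {p : A ⥤ B} {R S R' S' : B} {β : R ⟶ S} {β' : R' ⟶ S'}
    {a b : A} {φ : a ⟶ b} (h : p.IsStronglyCocartesian β φ) (h' : p.IsHomLift β' φ) :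
    p.IsStronglyCocartesian β' φ := by
  obtain rfl := IsHomLift.domain_eq p β φ
  obtain rfl := IsHomLift.codomain_eq p β φ
  obtain rfl := IsHomLift.domain_eq p β' φ
  obtain rfl := IsHomLift.codomain_eq p β' φ
  obtain rfl := IsHomLift.eq_of_isHomLift p β φ
  obtain rfl := IsHomLift.eq_of_isHomLift p β' φ
  exact h

/-- The morphisms sent to identities by `F`. Their domain and codomain need only have
propositionally equal images, the condition being expressed with `IsHomLift`. -/
def identityArrows (F : A ⥤ C) : MorphismProperty A := fun x _ w =>
  F.IsHomLift (𝟙 (F.obj x)) w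

end CategoryTheory.Functor

/-! ### Localization at the morphisms sent to identities -/

namespace CategoryTheory.Localization

open CategoryTheory.Functor

variable {A B C : Type*} [Category A] [Category B] [Category C] {F : A ⥤ C} {g : C ⥤ B}

/-- The morphisms out of the image of `F` that are vertical with respect to `g` have opcartesian
lifts along `F`. -/
def _root_.CategoryTheory.Functor.HasVerticalPushforwards (F : A ⥤ C) (g : C ⥤ B) : Prop :=
  ∀ (x : A) (d : C) (γ : F.obj x ⟶ d), g.IsHomLift (𝟙 (g.obj (F.obj x))) γ →
    ∃ (y : A) (l : x ⟶ y), F.IsStronglyCocartesian γ l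

theorem _root_.CategoryTheory.Functor.HasVerticalPushforwards.exists_lift
    (hF : F.HasVerticalPushforwards g) (x : A) {d d' : C}
    (hd : F.obj x = d) (γ : d ⟶ d') (hγ : g.IsHomLift (𝟙 (g.obj d)) γ) :
    ∃ (y : A) (l : x ⟶ y), F.IsStronglyCocartesian γ l := by
  subst hd
  exact hF x d' γ hγ

variable {s : F.identityArrows.Localization ⥤ C}

/-- A morphism `v` with invertible vertical image differs from an isomorphism, namely an opcartesian
lift of its image, by a morphism sent to an identity. -/
theorem isIso_Q_map (hF : F.HasVerticalPushforwards g) {x y : A} (v : x ⟶ y)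
    (hv : g.IsHomLift (𝟙 (g.obj (F.obj x))) (F.map v)) (hi : IsIso (F.map v)) :
    IsIso (F.identityArrows.Q.map v) := by
  obtain ⟨z, l, hl⟩ := hF x _ (F.map v) hv
  have hl' : IsIso l := IsStronglyCocartesian.isIso_of_base_isIso F (F.map v) l
  let w := IsStronglyCocartesian.map F (F.map v) l (Category.comp_id (F.map v)).symm v
  have hw : l ≫ w = v := IsStronglyCocartesian.fac F (F.map v) l _ v
  have hw' : F.IsHomLift (𝟙 (F.obj y)) w := inferInstance
  have : F.identityArrows w := by
    obtain e := IsHomLift.domain_eq F (𝟙 (F.obj y)) w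
    change F.IsHomLift (𝟙 (F.obj z)) w
    rw [e]
    exact hw'
  have := F.identityArrows.Q_inverts w this
  rw [← hw, F.identityArrows.Q.map_comp]
  infer_instance

/-- Pushing `x` forward along the vertical part of `i : F x ⟶ c` is functorial in `(x, i)`, and the
functor obtained extends to the slice category of `F.identityArrows.Localization` over `c`, the
opcartesian lifts `lam` remaining natural. The values of the extension are cartesian, they lie over
the comparisons between the cartesian parts, and they are invertible at the images of the
opcartesian morphisms of `A` over isomorphisms of `B`. -/
theorem exists_pushforward (hs : F.identityArrows.Q ⋙ s = F) (hF : F.HasVerticalPushforwards g)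
    (cA : Cleavage (F ⋙ g)) (cC : Cleavage g)
    (hW : cA.IsStable F.identityArrows)
    (hcart : ∀ {R S : B} (β : R ⟶ S) (a : A) (ha : g.obj (F.obj a) = S),
      g.IsStronglyCartesian β (F.map (cA.lift β a ha)))
    (c : C) :
    ∃ (obj : ∀ x, (s.obj (F.identityArrows.Q.obj x) ⟶ c) → A)
      (lam : ∀ x i, x ⟶ obj x i)
      (ext : ∀ {x y : A} (m : F.identityArrows.Q.obj x ⟶ F.identityArrows.Q.obj y)
        (i : s.obj (F.identityArrows.Q.obj x) ⟶ c) (j : s.obj (F.identityArrows.Q.obj y) ⟶ c),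
        i = s.map m ≫ j →
          (F.identityArrows.Q.obj (obj x i) ⟶ F.identityArrows.Q.obj (obj y j))),
      (∀ x i, F.IsStronglyCocartesian (cC.verticalPart i) (lam x i)) ∧
      (∀ {x y z : A} (m : F.identityArrows.Q.obj x ⟶ F.identityArrows.Q.obj y)
        (n : F.identityArrows.Q.obj y ⟶ F.identityArrows.Q.obj z) (i j k hij hjk hik),
        ext (m ≫ n) i k hik = ext m i j hij ≫ ext n j k hjk) ∧
      (∀ {x y : A} (m : F.identityArrows.Q.obj x ⟶ F.identityArrows.Q.obj y) (i j h),
        F.identityArrows.Q.map (lam x i) ≫ ext m i j h =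
          m ≫ F.identityArrows.Q.map (lam y j)) ∧
      (∀ {x y : A} (m : F.identityArrows.Q.obj x ⟶ F.identityArrows.Q.obj y) (i j h),
        s.IsHomLift (cC.cartesianPartMap (s.map m) i j h) (ext m i j h)) ∧
      (∀ {x y : A} (m : F.identityArrows.Q.obj x ⟶ F.identityArrows.Q.obj y) (i j h),
        (s ⋙ g).IsStronglyCartesian ((s ⋙ g).map (ext m i j h)) (ext m i j h)) ∧
      (∀ {x y : A} (e : x ⟶ y), F.IsStronglyCocartesian (F.map e) e → IsIso (g.map (F.map e)) →
        ∀ i j h, IsIso (ext (F.identityArrows.Q.map e) i j h)) := by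
  let Q := F.identityArrows.Q
  have hlift : ∀ (x : A) (i : s.obj (Q.obj x) ⟶ c), ∃ (y : A) (l : x ⟶ y),
      F.IsStronglyCocartesian (cC.verticalPart i) l := fun x i =>
    hF.exists_lift x (over_obj hs x) _ inferInstance
  choose obj lam hlam using hlift
  have hlift' : ∀ {x y : A} (u : x ⟶ y) (j : s.obj (Q.obj y) ⟶ c),
      F.IsHomLift (s.map (Q.map u) ≫ cC.verticalPart j) (u ≫ lam y j) := fun u j => by
    have := over_map hs u
    infer_instance
  let map : ∀ {x y : A} (u : x ⟶ y) (i : s.obj (Q.obj x) ⟶ c) (j : s.obj (Q.obj y) ⟶ c),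
      i = s.map (Q.map u) ≫ j → (obj x i ⟶ obj y j) := fun {x y} u i j h =>
    haveI := hlift' u j
    IsStronglyCocartesian.map F (cC.verticalPart i) (lam x i)
      (g := cC.cartesianPartMap (s.map (Q.map u)) i j h)
      (cC.verticalPart_cartesianPartMap _ _ _ h).symm (u ≫ lam y j)
  have map_lift : ∀ {x y : A} (u : x ⟶ y) i j h,
      F.IsHomLift (cC.cartesianPartMap (s.map (Q.map u)) i j h) (map u i j h) :=
    fun {x y} u i j h => by
      have := hlift' u j
      exact IsStronglyCocartesian.map_isHomLift _ _ _ _ _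
  have map_fac : ∀ {x y : A} (u : x ⟶ y) i j h, lam x i ≫ map u i j h = u ≫ lam y j :=
    fun {x y} u i j h => by
      have := hlift' u j
      exact IsStronglyCocartesian.fac _ _ _ _ _
  have map_ext : ∀ {x y : A} (u : s.obj (Q.obj x) ⟶ s.obj (Q.obj y)) i j (h : i = u ≫ j)
      (m n : obj x i ⟶ obj y j), F.IsHomLift (cC.cartesianPartMap u i j h) m →
        F.IsHomLift (cC.cartesianPartMap u i j h) n →
        lam x i ≫ m = lam x i ≫ n → m = n := fun {x y} u i j h m n hm hn e =>
      IsStronglyCocartesian.ext F (cC.verticalPart i) (lam x i) (cC.cartesianPartMap u i j h) e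
  -- `map u i j h` is the composite of a morphism `v` with invertible vertical image, which is
  -- inverted by `Q`, and of a chosen lift, whose image under `Q` is cartesian
  have map_cart : ∀ {x y : A} (u : x ⟶ y) i j h,
      (s ⋙ g).IsStronglyCartesian ((s ⋙ g).map (Q.map (map u i j h))) (Q.map (map u i j h)) := by
    intro x y u i j h
    have hκ := (map_lift u i j h).isStronglyCartesian_map (g := g)
      (β := g.map (s.map (Q.map u))) inferInstance
    have hl := cA.isStronglyCartesian ((F ⋙ g).map (map u i j h)) (obj y j) rfl
    let v := IsStronglyCartesian.map (F ⋙ g) ((F ⋙ g).map (map u i j h))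
      (cA.lift ((F ⋙ g).map (map u i j h)) (obj y j) rfl)
      (Category.id_comp _).symm (map u i j h)
    have hv : v ≫ cA.lift ((F ⋙ g).map (map u i j h)) (obj y j) rfl = map u i j h :=
      IsStronglyCartesian.fac _ _ _ _ _
    have hv' : (F ⋙ g).IsHomLift (𝟙 _) v := IsStronglyCartesian.map_isHomLift _ _ _ _ _
    have hv'' : g.IsHomLift (𝟙 (g.obj (F.obj (obj x i)))) (F.map v) :=
      (isHomLift_comp_iff F g).1 hv'
    have hFv : IsIso (F.map v) := by
      have e1 := hcart ((F ⋙ g).map (map u i j h)) (obj y j) rfl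
      have e2 : g.IsStronglyCartesian (𝟙 (g.obj (F.obj (obj x i))) ≫ (F ⋙ g).map (map u i j h))
          (F.map v ≫ F.map (cA.lift ((F ⋙ g).map (map u i j h)) (obj y j) rfl)) := by
        rw [← F.map_comp, hv, Category.id_comp]
        exact hκ.self
      have := IsStronglyCartesian.of_comp g (f := 𝟙 (g.obj (F.obj (obj x i)))) (φ := F.map v)
        (g := (F ⋙ g).map (map u i j h))
        (ψ := F.map (cA.lift ((F ⋙ g).map (map u i j h)) (obj y j) rfl))
      exact IsStronglyCartesian.isIso_of_base_isIso g (𝟙 (g.obj (F.obj (obj x i)))) _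
    have e3 : IsIso (Q.map v) := isIso_Q_map hF v hv'' hFv
    have hsg : Q ⋙ s ⋙ g = F ⋙ g := congrArg (· ⋙ g) hs
    have e4 := isStronglyCartesian_Q_map hW hsg hl
    have e5 : (s ⋙ g).IsHomLift (𝟙 _) (Q.map v) := isHomLift_Q_map hsg hv'
    have e6 : (s ⋙ g).IsStronglyCartesian (𝟙 _ ≫ (F ⋙ g).map (map u i j h))
      (Q.map v ≫ Q.map (cA.lift ((F ⋙ g).map (map u i j h)) (obj y j) rfl)) := inferInstance
    rw [← Q.map_comp, hv] at e6
    exact e6.self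
  obtain ⟨ext, h1, h2, h3⟩ := exists_extension_along_elements s
    (LiftingRelation.yoneda c) (fun x i => Q.obj (obj x i))
    (fun {x y} u i j h => Q.map (map u i j h))
    (fun x i h => by
      rw [← Q.map_id]
      congr 1
      refine map_ext (s.map (Q.map (𝟙 x))) i i h _ _ (map_lift _ _ _ _) ?_ ?_
      · have := hlam x i
        rw [cC.cartesianPartMap_id _ (by simp)]
        exact IsHomLift.id (IsHomLift.codomain_eq F (cC.verticalPart i) (lam x i))
      · rw [map_fac]; simp)
    (fun u v i j k hij hjk hik => by
      rw [← Q.map_comp]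
      congr 1
      refine map_ext (s.map (Q.map (u ≫ v))) i k hik _ _ (map_lift _ _ _ _) ?_ ?_
      · have e1 := map_lift u i j hij
        have e2 := map_lift v j k hjk
        have e3 : i = (s.map (Q.map u) ≫ s.map (Q.map v)) ≫ k := by
          rw [hij, hjk, Category.assoc]
        have e4 : ∀ (υ) (hυ : υ = s.map (Q.map u) ≫ s.map (Q.map v)) (h),
            F.IsHomLift (cC.cartesianPartMap υ i k h) (map u i j hij ≫ map v j k hjk) := by
          rintro _ rfl h
          rw [cC.cartesianPartMap_comp _ _ i j k hij hjk h]
          infer_instance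
        exact e4 _ (by simp) _
      · simp [map_fac, reassoc_of% map_fac])
    (fun {x y} u hu i j h => by
      refine F.identityArrows.Q_inverts _ ?_
      obtain ⟨e, he⟩ := (over_map hs u).eq_eqToHom (h' := rfl) (S' := F.obj x) hu
      have e4 : ∀ (υ) (hυ : υ = eqToHom e) (h : i = υ ≫ j), ∃ h', cC.cartesianPartMap υ i j h =
          eqToHom h' := by
        rintro _ rfl h
        exact cC.cartesianPartMap_eqToHom i j e h
      obtain ⟨h', e5⟩ := e4 _ he h
      have e6 := map_lift u i j h
      rw [e5] at e6
      exact e6.id_of_eqToHom)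
  refine ⟨obj, lam, ext, hlam, h2, fun m => ?_, fun m => ?_, fun m => ?_, fun e he he' i j h => ?_⟩
  · refine Q_hom_induction (P := fun {x y} m => ∀ (i : s.obj (Q.obj x) ⟶ c) j h,
      Q.map (lam x i) ≫ ext m i j h = m ≫ Q.map (lam y j))
      (fun m n hm hn i k hik => ?_) (fun u i j h => ?_) (fun e he j i h => ?_) m
    · have hij : i = s.map m ≫ s.map n ≫ k := by
        rw [hik, s.map_comp, Category.assoc]
      rw [h2 m n i _ k hij rfl hik, ← Category.assoc, hm, Category.assoc, hn, Category.assoc]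
    · rw [h1, ← Q.map_comp, map_fac, Q.map_comp]
    · have hij := rel_symm_of_iso s (LiftingRelation.yoneda c) e h
      have e1 := he i j hij
      have e2 : ext e.hom i j hij ≫ ext e.inv j i h = 𝟙 _ := h3 e i j hij h
      rw [← cancel_epi e.hom, ← reassoc_of% e1, e2]
      simp
  · refine Q_hom_induction (P := fun {x y} m => ∀ (i : s.obj (Q.obj x) ⟶ c) j h,
      s.IsHomLift (cC.cartesianPartMap (s.map m) i j h) (ext m i j h))
      (fun m n hm hn i k hik => ?_) (fun u i j h => ?_) (fun e he j i h => ?_) m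
    · have hij : i = s.map m ≫ s.map n ≫ k := by
        rw [hik, s.map_comp, Category.assoc]
      rw [h2 m n i _ k hij rfl hik]
      have := hm i _ hij
      have := hn _ k rfl
      have e4 : ∀ (υ) (hυ : υ = s.map m ≫ s.map n) (h), cC.cartesianPartMap υ i k h =
          cC.cartesianPartMap _ i _ hij ≫ cC.cartesianPartMap _ _ k rfl := by
        rintro _ rfl h
        exact cC.cartesianPartMap_comp _ _ i _ k hij rfl h
      rw [e4 _ (s.map_comp m n)]
      infer_instance
    · rw [h1]
      exact isHomLift_Q_map hs (map_lift u i j h)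
    · have hij := rel_symm_of_iso s (LiftingRelation.yoneda c) e h
      have := he i j hij
      have hid : s.map e.hom ≫ s.map e.inv = 𝟙 _ := by rw [← s.map_comp, e.hom_inv_id, s.map_id]
      have hid' : s.map e.inv ≫ s.map e.hom = 𝟙 _ := by rw [← s.map_comp, e.inv_hom_id, s.map_id]
      let κ : cC.dom (g.map i) c rfl ≅ cC.dom (g.map j) c rfl :=
        ⟨cC.cartesianPartMap (s.map e.hom) i j hij,
        cC.cartesianPartMap (s.map e.inv) j i h,
        by rw [← cC.cartesianPartMap_comp _ _ i j i hij h (by rw [hid, Category.id_comp]),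
          cC.cartesianPartMap_id _ hid],
        by rw [← cC.cartesianPartMap_comp _ _ j i j h hij (by rw [hid', Category.id_comp]),
          cC.cartesianPartMap_id _ hid']⟩
      exact IsHomLift.inv_lift_inv s κ
        ⟨ext e.hom i j hij, ext e.inv j i h, h3 e i j hij h, h3 e.symm j i h hij⟩
  · refine Q_hom_induction (P := fun {x y} m => ∀ (i : s.obj (Q.obj x) ⟶ c) j h,
      (s ⋙ g).IsStronglyCartesian ((s ⋙ g).map (ext m i j h)) (ext m i j h))
      (fun m n hm hn i k hik => ?_) (fun u i j h => ?_) (fun e he j i h => ?_) m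
    · have hij : i = s.map m ≫ s.map n ≫ k := by
        rw [hik, s.map_comp, Category.assoc]
      rw [h2 m n i _ k hij rfl hik, (s ⋙ g).map_comp]
      have := hm i _ hij
      have := hn _ k rfl
      infer_instance
    · rw [h1]
      exact map_cart u i j h
    · have hij := rel_symm_of_iso s (LiftingRelation.yoneda c) e h
      have : IsIso (ext e.inv j i h) := ⟨ext e.hom i j hij, h3 e.symm j i h hij, h3 e i j hij h⟩
      infer_instance
  · have := hlam _ i
    have := hlam _ j
    have hQe := over_map hs e
    have e1 : F.IsStronglyCocartesian (cC.verticalPart i ≫ cC.cartesianPartMap _ i j h)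
        (lam _ i ≫ map e i j h) := by
      rw [map_fac, cC.verticalPart_cartesianPartMap]
      have := he.congr_base hQe
      infer_instance
    have e2 := map_lift e i j h
    have := IsStronglyCocartesian.of_comp F (f := cC.verticalPart i) (φ := lam _ i)
      (g := cC.cartesianPartMap _ i j h) (ψ := map e i j h)
    have : IsIso (g.map (s.map (Q.map e))) := hQe.comp_right.isIso_map_iff.1 he'
    have : IsIso (cC.cartesianPartMap _ i j h) :=
      IsStronglyCartesian.isIso_of_base_isIso g (g.map (s.map (Q.map e))) _
    have := IsStronglyCocartesian.isIso_of_base_isIso F (cC.cartesianPartMap _ i j h) (map e i j h)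
    have e3 : ext (Q.map e) i j h = Q.map (map e i j h) := h1 e i j h
    change IsIso (ext (Q.map e) i j h)
    rw [e3]
    infer_instance

/-- The functor `s` induced by `F` on the localization is conservative. For `m : X ⟶ Y` with `s m`
invertible, the pushforwards of `X` and `Y` along the vertical parts of `s m` and of the identity of
`s Y` are isomorphic to `X` and `Y`, and `m` corresponds to a morphism between them that is
cartesian over an isomorphism. -/
theorem isIso_of_isIso_map (hs : F.identityArrows.Q ⋙ s = F) (hF : F.HasVerticalPushforwards g)
    (cA : Cleavage (F ⋙ g)) (cC : Cleavage g)
    (hW : cA.IsStable F.identityArrows)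
    (hcart : ∀ {R S : B} (β : R ⟶ S) (a : A) (ha : g.obj (F.obj a) = S),
      g.IsStronglyCartesian β (F.map (cA.lift β a ha)))
    {X Y : F.identityArrows.Localization} (m : X ⟶ Y) (hm : IsIso (s.map m)) : IsIso m := by
  obtain ⟨x, rfl⟩ := Q_obj_surjective _ X
  obtain ⟨y, rfl⟩ := Q_obj_surjective _ Y
  obtain ⟨obj, lam, ext, hlam, h1, h2, h3, h4, h5⟩ :=
    exists_pushforward hs hF cA cC hW hcart (s.obj (F.identityArrows.Q.obj y))
  have hiso : ∀ x i, IsIso i → IsIso (F.identityArrows.Q.map (lam x i)) := fun x i hi => by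
    have := cC.isIso_verticalPart i hi
    have := hlam x i
    have := IsStronglyCocartesian.isIso_of_base_isIso F (cC.verticalPart i) (lam x i)
    infer_instance
  have hx := hiso x (s.map m) hm
  have hy := hiso y (𝟙 _) inferInstance
  have e := h2 m (s.map m) (𝟙 _) (Category.comp_id _).symm
  have hsm : IsIso (s.map (ext m (s.map m) (𝟙 _) (Category.comp_id _).symm)) := by
    have e' := congrArg s.map e
    rw [s.map_comp, s.map_comp, ← IsIso.eq_inv_comp] at e'
    rw [e']
    infer_instance
  have hc := h4 m (s.map m) (𝟙 _) (Category.comp_id _).symm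
  have : IsIso ((s ⋙ g).map (ext m (s.map m) (𝟙 _) (Category.comp_id _).symm)) :=
    inferInstanceAs (IsIso (g.map (s.map _)))
  have := IsStronglyCartesian.isIso_of_base_isIso (s ⋙ g)
    ((s ⋙ g).map (ext m (s.map m) (𝟙 _) (Category.comp_id _).symm))
    (ext m (s.map m) (𝟙 _) (Category.comp_id _).symm)
  rw [← IsIso.comp_inv_eq] at e
  rw [← e]
  infer_instance

/-- The localization functor preserves the opcartesian morphisms `e : x ⟶ y` over isomorphisms of
`B`: for `δ : s y ⟶ s z`, the pushforwards of `x` and `y` along the vertical parts of `s e ≫ δ` and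
`δ` are isomorphic, so that a morphism `x ⟶ z` over `s e ≫ δ` factors through `e`. -/
theorem isStronglyCocartesian_Q_map (hs : F.identityArrows.Q ⋙ s = F)
    (hF : F.HasVerticalPushforwards g)
    (cA : Cleavage (F ⋙ g)) (cC : Cleavage g)
    (hW : cA.IsStable F.identityArrows)
    (hcart : ∀ {R S : B} (β : R ⟶ S) (a : A) (ha : g.obj (F.obj a) = S),
      g.IsStronglyCartesian β (F.map (cA.lift β a ha)))
    {x y : A} {e : x ⟶ y} {d d' : C} {γ : d ⟶ d'} (he : F.IsStronglyCocartesian γ e)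
    (hγ : IsIso (g.map γ)) : s.IsStronglyCocartesian γ (F.identityArrows.Q.map e) := by
  have hl : s.IsHomLift γ (F.identityArrows.Q.map e) := isHomLift_Q_map hs inferInstance
  obtain rfl : s.obj (F.identityArrows.Q.obj x) = d :=
    IsHomLift.domain_eq s γ (F.identityArrows.Q.map e)
  obtain rfl : s.obj (F.identityArrows.Q.obj y) = d' :=
    IsHomLift.codomain_eq s γ (F.identityArrows.Q.map e)
  obtain rfl : γ = s.map (F.identityArrows.Q.map e) := IsHomLift.eq_of_isHomLift s γ _
  have he' : F.IsStronglyCocartesian (F.map e) e := he.congr_base inferInstance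
  have hge : IsIso (g.map (F.map e)) := he.toIsHomLift.comp_right.isIso_map_iff.2 hγ
  refine { universal_property' := fun {Z} δ φ hφ => ?_ }
  obtain ⟨z, rfl⟩ := Q_obj_surjective _ Z
  obtain ⟨obj, lam, ext, hlam, h1, h2, h3, h4, h5⟩ :=
    exists_pushforward hs hF cA cC hW hcart (s.obj (F.identityArrows.Q.obj z))
  have hφ' : s.map φ = s.map (F.identityArrows.Q.map e) ≫ δ :=
    (IsHomLift.eq_of_isHomLift s _ φ).symm
  have hz : IsIso (F.identityArrows.Q.map (lam z (𝟙 _))) := by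
    have := cC.isIso_verticalPart (𝟙 (s.obj (F.identityArrows.Q.obj z))) inferInstance
    have := hlam z (𝟙 _)
    have := IsStronglyCocartesian.isIso_of_base_isIso F
      (cC.verticalPart (𝟙 (s.obj (F.identityArrows.Q.obj z)))) (lam z (𝟙 _))
    infer_instance
  have hxy := h5 e he' hge _ δ rfl
  have e1 := h2 φ _ (𝟙 _) (hφ'.symm.trans (Category.comp_id _).symm)
  have e2 := h2 (F.identityArrows.Q.map e) _ δ rfl
  let χ := F.identityArrows.Q.map (lam y δ) ≫ inv (ext (F.identityArrows.Q.map e) _ δ rfl) ≫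
    ext φ _ (𝟙 _) (hφ'.symm.trans (Category.comp_id _).symm) ≫
      inv (F.identityArrows.Q.map (lam z (𝟙 _)))
  have hχ : F.identityArrows.Q.map e ≫ χ = φ := by
    simp only [χ]
    rw [← reassoc_of% e2, IsIso.hom_inv_id_assoc, reassoc_of% e1, IsIso.hom_inv_id,
      Category.comp_id]
  refine ⟨χ, ⟨?_, hχ⟩, fun m hm => ?_⟩
  · have l1 : s.IsHomLift (cC.verticalPart δ) (F.identityArrows.Q.map (lam y δ)) :=
      isHomLift_Q_map hs (hlam y δ).toIsHomLift
    have l2 := h3 (F.identityArrows.Q.map e) _ δ rfl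
    have l3 := h3 φ _ (𝟙 _) (hφ'.symm.trans (Category.comp_id _).symm)
    have l4 : s.IsHomLift (cC.verticalPart (𝟙 _)) (F.identityArrows.Q.map (lam z (𝟙 _))) :=
      isHomLift_Q_map hs (hlam z (𝟙 _)).toIsHomLift
    have i2 := IsHomLift.isIso_of_lift_isIso s
      (cC.cartesianPartMap (s.map (F.identityArrows.Q.map e)) _ δ rfl)
      (ext (F.identityArrows.Q.map e) _ δ rfl)
    have i4 := IsHomLift.isIso_of_lift_isIso s
      (cC.verticalPart (𝟙 (s.obj (F.identityArrows.Q.obj z))))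
      (F.identityArrows.Q.map (lam z (𝟙 _)))
    have e3 : inv (cC.verticalPart (𝟙 (s.obj (F.identityArrows.Q.obj z)))) =
        cC.lift (g.map (𝟙 _)) _ rfl :=
      IsIso.inv_eq_of_hom_inv_id (cC.verticalPart_lift _)
    have e4 : δ = cC.verticalPart δ ≫ inv (cC.cartesianPartMap _ _ δ rfl) ≫
        cC.cartesianPartMap _ _ (𝟙 _) (hφ'.symm.trans (Category.comp_id _).symm) ≫
          inv (cC.verticalPart (𝟙 _)) := by
      rw [e3, cC.cartesianPartMap_lift,
        ← cC.cartesianPartMap_lift (s.map (F.identityArrows.Q.map e)) _ δ rfl,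
        IsIso.inv_hom_id_assoc, cC.verticalPart_lift]
    have e5 : s.IsHomLift (cC.verticalPart δ ≫ inv (cC.cartesianPartMap _ _ δ rfl) ≫
        cC.cartesianPartMap _ _ (𝟙 _) (hφ'.symm.trans (Category.comp_id _).symm) ≫
          inv (cC.verticalPart (𝟙 _))) χ := inferInstance
    rwa [← e4] at e5
  · obtain ⟨hm, hm'⟩ := hm
    obtain rfl : δ = s.map m := IsHomLift.eq_of_isHomLift s δ m
    have e3 := h1 (F.identityArrows.Q.map e) m _ _ (𝟙 _) rfl (Category.comp_id _).symm
      (by simp)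
    have e4 := h2 m _ (𝟙 _) (Category.comp_id _).symm
    simp only [χ]
    subst hm'
    rw [e3, Category.assoc, IsIso.inv_hom_id_assoc, reassoc_of% e4, IsIso.hom_inv_id,
      Category.comp_id]

end CategoryTheory.Localization

/-! ### Comma objects in `Fib(B)` -/

theorem CategoryTheory.Over.mk_eq_mk_iff {C : Type*} [Category C] {x y z : C} {f : x ⟶ z}
    {g : y ⟶ z} : Over.mk f = Over.mk g ↔ ∃ h : x = y, f = eqToHom h ≫ g := by
  constructor
  · intro h
    have key : ∀ (X : Over z), Over.mk f = X → ∃ h : x = X.left, f = eqToHom h ≫ X.hom := by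
      rintro _ rfl
      exact ⟨rfl, by simp⟩
    exact key _ h
  · rintro ⟨rfl, rfl⟩
    simp

namespace CategoryTheory.Functor

theorem isHomLift_of_square {B X : Type*} [Category B] [Category X] {p : X ⥤ B} {a b c d : X}
    {u : a ⟶ b} {v : c ⟶ d} {γ : a ⟶ c} {δ : b ⟶ d} (e : u ≫ δ = γ ≫ v)
    (hγ : p.IsHomLift (𝟙 (p.obj a)) γ) (hδ : p.IsHomLift (𝟙 (p.obj b)) δ) {R S : B} {β : R ⟶ S}
    (hu : p.IsHomLift β u) : p.IsHomLift β v := by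
  obtain rfl := IsHomLift.domain_eq p β u
  obtain rfl := IsHomLift.codomain_eq p β u
  obtain rfl := IsHomLift.eq_of_isHomLift p β u
  refine IsHomLift.of_fac' _ _ _ (IsHomLift.codomain_eq p (𝟙 (p.obj a)) γ)
    (IsHomLift.codomain_eq p (𝟙 (p.obj b)) δ) ?_
  have e' := congrArg p.map e
  rw [p.map_comp, p.map_comp, IsHomLift.fac' p (𝟙 (p.obj a)) γ,
    IsHomLift.fac' p (𝟙 (p.obj b)) δ] at e'
  simp only [eqToHom_refl, Category.id_comp] at e'
  rw [e']
  simp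

theorem isHomLift_of_square' {B X : Type*} [Category B] [Category X] {p : X ⥤ B} {a b c d : X}
    {u : a ⟶ b} {v : c ⟶ d} {γ : a ⟶ c} {δ : b ⟶ d} (e : u ≫ δ = γ ≫ v)
    (hγ : p.IsHomLift (𝟙 (p.obj a)) γ) (hδ : p.IsHomLift (𝟙 (p.obj b)) δ) {R S : B} {β : R ⟶ S}
    (hv : p.IsHomLift β v) : p.IsHomLift β u := by
  have h : p.IsHomLift (p.map u) v := isHomLift_of_square e hγ hδ inferInstance
  obtain rfl := IsHomLift.domain_eq p β v
  obtain rfl := IsHomLift.codomain_eq p β v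
  obtain rfl := IsHomLift.eq_of_isHomLift p β v
  refine IsHomLift.of_fac _ _ _ (IsHomLift.domain_eq p (p.map u) v).symm
    (IsHomLift.codomain_eq p (p.map u) v).symm ?_
  rw [IsHomLift.fac' p (p.map u) v]

end CategoryTheory.Functor

namespace Fib

open CategoryTheory.Functor

variable {B : Type u₁} [Category.{v₁} B]

/-- Preservation of the cleavage as an equation between morphisms. -/
theorem preservesCleavage_iff {X Y : Fib.{u} B} {F : BasedFunctor X.based Y.based} :
    PreservesCleavage F ↔ ∀ ⦃R S : B⦄ (β : R ⟶ S) (a : X.based.obj) (ha : X.based.p.obj a = S),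
      ∃ h, F.map (X.cleavage.lift β a ha) =
        eqToHom h ≫ Y.cleavage.lift β (F.obj a) ((F.w_obj a).trans ha) := by
  simp only [PreservesCleavage, Over.mk_eq_mk_iff]

theorem Mor.map_lift {X Y : Fib.{u} B} (F : Mor X Y) {R S : B} (β : R ⟶ S) (a : X.based.obj)
    (ha : X.based.p.obj a = S) : ∃ h, F.toBased.map (X.cleavage.lift β a ha) =
        eqToHom h ≫ Y.cleavage.lift β (F.toBased.obj a) ((F.toBased.w_obj a).trans ha) :=
  preservesCleavage_iff.1 F.preserves β a ha

theorem Mor.isStronglyCartesian_map_lift {X Y : Fib.{u} B} (F : Mor X Y) {R S : B} (β : R ⟶ S)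
    (a : X.based.obj) (ha : X.based.p.obj a = S) :
    Y.based.p.IsStronglyCartesian β (F.toBased.map (X.cleavage.lift β a ha)) := by
  obtain ⟨h, e⟩ := F.map_lift β a ha
  have := Y.cleavage.isStronglyCartesian β (F.toBased.obj a) ((F.toBased.w_obj a).trans ha)
  have hd := IsHomLift.domain_eq Y.based.p β
    (Y.cleavage.lift β (F.toBased.obj a) ((F.toBased.w_obj a).trans ha))
  have := IsHomLift.eqToHom_codomain_lift_id h hd
  have h2 : Y.based.p.IsStronglyCartesian (𝟙 R ≫ β)
    (eqToHom h ≫ Y.cleavage.lift β (F.toBased.obj a) ((F.toBased.w_obj a).trans ha)) :=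
    inferInstance
  rw [e]
  rwa [Category.id_comp] at h2

/-- The objects of the comma object of a 1-cell `F : X ⟶ Z` and the identity of `Z`, restricted to a
class `P` of morphisms of `Z`: the morphisms in `P` out of the image of an object of `X`. When `P`
is stable in the sense of `Cleavage.IsStable`, they are the objects of an object of `Fib(B)`. For
`P` the vertical morphisms it is the usual comma object; for `F` an identity and `P` the morphisms
sent to identities by a 1-cell `p`, it is the domain of the identee of `p`. -/
structure CommaObj {X Z : Fib.{u} B} (F : Mor X Z) (P : MorphismProperty Z.based.obj) where
  /-- the object of `X` -/
  left : X.based.obj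
  /-- the object of `Z` -/
  right : Z.based.obj
  /-- the morphism of `Z` -/
  hom : F.toBased.obj left ⟶ right
  mem : P hom

namespace CommaObj

variable {X Z : Fib.{u} B} {F : Mor X Z} {P : MorphismProperty Z.based.obj}

theorem ext' {a b : CommaObj F P} (hl : a.left = b.left) (hr : a.right = b.right)
    (h : a.hom = eqToHom (by rw [hl]) ≫ b.hom ≫ eqToHom hr.symm) : a = b := by
  obtain ⟨l, r, f, _⟩ := a
  obtain ⟨l', r', f', _⟩ := b
  obtain rfl : l = l' := hl
  obtain rfl : r = r' := hr
  obtain rfl : f = f' := by simpa using h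
  rfl

/-- A morphism of the comma object: a commutative square. -/
@[ext]
structure Hom (a b : CommaObj F P) where
  /-- the component in `X` -/
  left : a.left ⟶ b.left
  /-- the component in `Z` -/
  right : a.right ⟶ b.right
  w : F.toBased.map left ≫ b.hom = a.hom ≫ right

instance : Category (CommaObj F P) where
  Hom := Hom
  id a := ⟨𝟙 _, 𝟙 _, by simp⟩
  comp f g := ⟨f.left ≫ g.left, f.right ≫ g.right, by simp [g.w, reassoc_of% f.w]⟩

@[ext]
theorem hom_ext {a b : CommaObj F P} {f g : a ⟶ b} (hl : f.left = g.left)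
    (hr : f.right = g.right) : f = g :=
  Hom.ext hl hr

@[simp] theorem eqToHom_left {a b : CommaObj F P} (h : a = b) :
    (eqToHom h).left = eqToHom (congrArg left h) := by
  subst h; rfl

@[simp] theorem eqToHom_right {a b : CommaObj F P} (h : a = b) :
    (eqToHom h).right = eqToHom (congrArg right h) := by
  subst h; rfl

variable (F P) in
/-- The first projection, as a functor. -/
def fstFunctor : CommaObj F P ⥤ X.based.obj where
  obj a := a.left
  map f := f.left

variable (F P) in
/-- The second projection, as a functor. -/
def sndFunctor : CommaObj F P ⥤ Z.based.obj where
  obj a := a.right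
  map f := f.right

theorem isHomLift_hom (hP : Z.cleavage.IsStable P) (a : CommaObj F P) :
    Z.based.p.IsHomLift (𝟙 (Z.based.p.obj (F.toBased.obj a.left))) a.hom :=
  hP.vertical _ a.mem

theorem isHomLift_right_iff (hP : Z.cleavage.IsStable P) {a b : CommaObj F P} (f : a ⟶ b) {R S : B}
    {β : R ⟶ S} : Z.based.p.IsHomLift β f.right ↔ X.based.p.IsHomLift β f.left := by
  rw [← F.toBased.isHomLift_iff]
  exact ⟨isHomLift_of_square' f.w (a.isHomLift_hom hP) (b.isHomLift_hom hP),
    isHomLift_of_square f.w (a.isHomLift_hom hP) (b.isHomLift_hom hP)⟩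

theorem obj_right (hP : Z.cleavage.IsStable P) (a : CommaObj F P) {S : B}
    (ha : X.based.p.obj a.left = S) : Z.based.p.obj a.right = S := by
  have := a.isHomLift_hom hP
  rw [IsHomLift.codomain_eq Z.based.p (𝟙 (Z.based.p.obj (F.toBased.obj a.left))) a.hom,
    F.toBased.w_obj, ha]

theorem isHomLift_hom' (hP : Z.cleavage.IsStable P) (a : CommaObj F P) {S : B}
    (ha : X.based.p.obj a.left = S) : Z.based.p.IsHomLift (𝟙 S) a.hom := by
  subst ha
  rw [← F.toBased.w_obj]
  exact a.isHomLift_hom hP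

/-- The reindexing of the morphism `a.hom` along `β`. -/
noncomputable def reindexHom (hP : Z.cleavage.IsStable P) {R S : B} (β : R ⟶ S) (a : CommaObj F P)
    (ha : X.based.p.obj a.left = S) : F.toBased.obj (X.cleavage.dom β a.left ha) ⟶
      Z.cleavage.dom β a.right (a.obj_right hP ha) :=
  eqToHom (F.map_lift β a.left ha).1 ≫
    Z.cleavage.map β β ((F.toBased.w_obj a.left).trans ha) (a.obj_right hP ha) a.hom
      (a.isHomLift_hom' hP ha) (Category.comp_id _)

theorem reindexHom_lift (hP : Z.cleavage.IsStable P) {R S : B} (β : R ⟶ S) (a : CommaObj F P)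
    (ha : X.based.p.obj a.left = S) :
    a.reindexHom hP β ha ≫ Z.cleavage.lift β a.right (a.obj_right hP ha) =
      F.toBased.map (X.cleavage.lift β a.left ha) ≫ a.hom := by
  obtain ⟨h, e⟩ := F.map_lift β a.left ha
  simp only [reindexHom, Category.assoc, Cleavage.map_lift, e]

instance isHomLift_reindexHom (hP : Z.cleavage.IsStable P) {R S : B} (β : R ⟶ S)
    (a : CommaObj F P) (ha : X.based.p.obj a.left = S) :
    Z.based.p.IsHomLift (𝟙 R) (a.reindexHom hP β ha) := by
  unfold reindexHom
  infer_instance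

/-- The reindexing of an object of the comma object along `β`. -/
noncomputable def reindex (hP : Z.cleavage.IsStable P) {R S : B} (β : R ⟶ S) (a : CommaObj F P)
    (ha : X.based.p.obj a.left = S) : CommaObj F P where
  left := X.cleavage.dom β a.left ha
  right := Z.cleavage.dom β a.right (a.obj_right hP ha)
  hom := a.reindexHom hP β ha
  mem := by
    have h := hP.map_mem β β ((F.toBased.w_obj a.left).trans ha) (a.obj_right hP ha) a.hom
      (a.isHomLift_hom' hP ha) (Category.comp_id _) a.mem
    have key : ∀ {x y z : Z.based.obj} (e : x = y) (f : y ⟶ z), P f → P (eqToHom e ≫ f) := by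
      rintro _ _ _ rfl f hf
      simpa using hf
    exact key _ _ h

/-- The chosen lift of `β`, whose components are the chosen lifts of `β` in `X` and `Z`. -/
noncomputable def reindexLift (hP : Z.cleavage.IsStable P) {R S : B} (β : R ⟶ S)
    (a : CommaObj F P) (ha : X.based.p.obj a.left = S) : a.reindex hP β ha ⟶ a where
  left := X.cleavage.lift β a.left ha
  right := Z.cleavage.lift β a.right (a.obj_right hP ha)
  w := (a.reindexHom_lift hP β ha).symm

/-- The objects with the domain of a chosen lift as left and right components and with the square
commuting are the reindexed ones: the second component of the lift being cartesian, the morphism is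
determined. -/
theorem eq_reindex (hP : Z.cleavage.IsStable P) {R S : B} (β : R ⟶ S) {a c : CommaObj F P}
    (ha : X.based.p.obj a.left = S) (hl : c.left = X.cleavage.dom β a.left ha)
    (hr : c.right = Z.cleavage.dom β a.right (a.obj_right hP ha))
    (e : c.hom ≫ eqToHom hr ≫ Z.cleavage.lift β a.right (a.obj_right hP ha) =
      eqToHom (congrArg F.toBased.obj hl) ≫ F.toBased.map (X.cleavage.lift β a.left ha) ≫ a.hom) :
    c = a.reindex hP β ha := by
  refine ext' hl hr ?_
  have hX := X.cleavage.isStronglyCartesian β a.left ha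
  have hc : X.based.p.obj c.left = R :=
    (congrArg _ hl).trans (IsHomLift.domain_eq X.based.p β (X.cleavage.lift β a.left ha))
  have := c.isHomLift_hom' hP hc
  have key : c.hom ≫ eqToHom hr = eqToHom (congrArg F.toBased.obj hl) ≫ a.reindexHom hP β ha := by
    refine Z.cleavage.hom_ext (a.obj_right hP ha) (𝟙 R) β inferInstance inferInstance ?_
    rw [Category.assoc, e, Category.assoc, a.reindexHom_lift]
  exact ((comp_eqToHom_iff hr _ _).1 key).trans (Category.assoc _ _ _)

theorem isStronglyCartesian_reindexLift (hP : Z.cleavage.IsStable P) {R S : B} (β : R ⟶ S)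
    (a : CommaObj F P) (ha : X.based.p.obj a.left = S) :
    (fstFunctor F P ⋙ X.based.p).IsStronglyCartesian β (a.reindexLift hP β ha) := by
  have h1 := X.cleavage.isStronglyCartesian β a.left ha
  have h2 := Z.cleavage.isStronglyCartesian β a.right (a.obj_right hP ha)
  have h3 : (fstFunctor F P ⋙ X.based.p).IsHomLift β (a.reindexLift hP β ha) :=
    (isHomLift_comp_iff _ _).2 h1.toIsHomLift
  refine { universal_property' := fun {b} g φ hφ => ?_ }
  have hl : X.based.p.IsHomLift (g ≫ β) φ.left := (isHomLift_comp_iff (fstFunctor F P) _).1 hφ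
  have hr : Z.based.p.IsHomLift (g ≫ β) φ.right := (isHomLift_right_iff hP φ).2 hl
  obtain ⟨l, ⟨l1, l2⟩, l3⟩ := IsStronglyCartesian.universal_property X.based.p β
    (X.cleavage.lift β a.left ha) g (g ≫ β) rfl φ.left
  obtain ⟨r, ⟨r1, r2⟩, r3⟩ := IsStronglyCartesian.universal_property Z.based.p β
    (Z.cleavage.lift β a.right (a.obj_right hP ha)) g (g ≫ β) rfl φ.right
  have hw : F.toBased.map l ≫ a.reindexHom hP β ha = b.hom ≫ r := by
    have i2 := b.isHomLift_hom' hP rfl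
    have i3 := IsHomLift.comp_lift_id_left' Z.based.p
      (X.based.p.obj b.left) b.hom g r
    refine Z.cleavage.hom_ext (a.obj_right hP ha) g β inferInstance i3 ?_
    rw [Category.assoc, Category.assoc, r2, reindexHom_lift, ← F.toBased.map_comp_assoc, l2, φ.w]
  refine ⟨⟨l, r, hw⟩, ⟨?_, ?_⟩, fun χ hχ => ?_⟩
  · exact (isHomLift_comp_iff _ _).2 l1
  · exact hom_ext l2 r2
  · obtain ⟨c1, rfl⟩ := hχ
    have c2 : X.based.p.IsHomLift g χ.left := (isHomLift_comp_iff (fstFunctor F P) _).1 c1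
    exact hom_ext (l3 _ ⟨c2, rfl⟩) (r3 _ ⟨(isHomLift_right_iff hP χ).2 c2, rfl⟩)

/-- The comma object, with the functor to `B` and the cleavage coming from those of `X` and `Z`. -/
noncomputable def fib (F : Mor X Z) (hP : Z.cleavage.IsStable P) : Fib.{u} B where
  based := BasedCategory.ofFunctor (fstFunctor F P ⋙ X.based.p)
  cleavage :=
    { dom := fun β a ha => reindex hP β a ha
      lift := fun β a ha => reindexLift hP β a ha
      isStronglyCartesian := fun β a ha => isStronglyCartesian_reindexLift hP β a ha }

/-- The first projection, as a 1-cell. -/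
noncomputable def fst (F : Mor X Z) (hP : Z.cleavage.IsStable P) : fib F hP ⟶ X where
  toBased := { toFunctor := fstFunctor F P, w := rfl }
  preserves := fun _ _ _ _ _ => rfl

/-- The second projection, as a 1-cell. -/
noncomputable def snd (F : Mor X Z) (hP : Z.cleavage.IsStable P) : fib F hP ⟶ Z where
  toBased :=
    { toFunctor := sndFunctor F P
      w := by
        refine Functor.ext_of_iso (NatIso.ofComponents
          (fun a => eqToIso (a.obj_right hP rfl)) fun {a b} f => ?_) (fun a => a.obj_right hP rfl)
        have : Z.based.p.IsHomLift (X.based.p.map f.left) f.right :=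
          (isHomLift_right_iff hP f).2 inferInstance
        have e := IsHomLift.fac' Z.based.p (X.based.p.map f.left) f.right
        change Z.based.p.map f.right ≫ eqToHom (b.obj_right hP rfl) =
          eqToHom (a.obj_right hP rfl) ≫ X.based.p.map f.left
        rw [e]
        simp }
  preserves := fun _ _ _ _ _ => rfl

/-- The universal 2-cell, with component `a.hom` at `a`. -/
noncomputable def cell (F : X ⟶ Z) (hP : Z.cleavage.IsStable P) :
    fst F hP ≫ F ⟶ snd F hP where
  toNatTrans :=
    { app := fun a => a.hom
      naturality := fun _ _ f => f.w }
  isHomLift' := fun a => a.isHomLift_hom' hP rfl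

/-- The 1-cell to the comma object induced by a 2-cell with components `θ t` in `P`. It preserves
the cleavages strictly because reindexed objects are determined by their components. -/
noncomputable def lift {F : X ⟶ Z} (hP : Z.cleavage.IsStable P) {T : Fib.{u} B} (a : T ⟶ X)
    (b : T ⟶ Z) (θ : ∀ t, F.toBased.obj (a.toBased.obj t) ⟶ b.toBased.obj t)
    (naturality : ∀ {t t'} (f : t ⟶ t'), F.toBased.map (a.toBased.map f) ≫ θ t' =
      θ t ≫ b.toBased.map f) (hθ : ∀ t, P (θ t)) : T ⟶ fib F hP where
  toBased :=
    { toFunctor :=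
        { obj := fun t => ⟨a.toBased.obj t, b.toBased.obj t, θ t, hθ t⟩
          map := fun f => ⟨a.toBased.map f, b.toBased.map f, naturality f⟩
          map_id := fun t => hom_ext (a.toBased.map_id t) (b.toBased.map_id t)
          map_comp := fun f g => hom_ext (a.toBased.map_comp f g) (b.toBased.map_comp f g) }
      w := a.toBased.w }
  preserves := by
    refine preservesCleavage_iff.2 fun R S β t ht => ?_
    obtain ⟨h1, e1⟩ := a.map_lift β t ht
    obtain ⟨h2, e2⟩ := b.map_lift β t ht
    let x : CommaObj F P := ⟨a.toBased.obj t, b.toBased.obj t, θ t, hθ t⟩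
    let y : CommaObj F P := ⟨a.toBased.obj (T.cleavage.dom β t ht),
      b.toBased.obj (T.cleavage.dom β t ht), θ _, hθ _⟩
    have hxy : y = x.reindex hP β ((a.toBased.w_obj t).trans ht) := by
      refine eq_reindex hP β _ h1 h2 ?_
      change θ _ ≫ _ = _
      rw [← e2, ← naturality, e1, F.toBased.map_comp, eqToHom_map, Category.assoc]
    refine ⟨hxy, hom_ext ?_ ?_⟩
    · refine e1.trans ?_
      change _ = (eqToHom hxy).left ≫ _
      rw [eqToHom_left]
      rfl
    · refine e2.trans ?_
      change _ = (eqToHom hxy).right ≫ _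
      rw [eqToHom_right]
      rfl

end CommaObj

end Fib

/-! ### Components of 2-cells -/

namespace Fib

open CategoryTheory.Functor Bicategory TwoCategory

variable {B : Type u₁} [Category.{v₁} B]

section Cells

variable {X Y Z T : Fib.{u} B}

/-- The functor underlying a 1-cell. -/
abbrev functor (F : X ⟶ Y) : X.based.obj ⥤ Y.based.obj := F.toBased.toFunctor

theorem functor_injective {F G : X ⟶ Y} (h : functor F = functor G) : F = G := by
  obtain ⟨⟨F, _⟩, _⟩ := F
  obtain ⟨⟨G, _⟩, _⟩ := G
  obtain rfl : F = G := h
  rfl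

theorem functor_comp_p (F : X ⟶ Y) : functor F ⋙ Y.based.p = X.based.p := F.toBased.w

/-- The component of a 2-cell at an object. -/
def app {F G : X ⟶ Y} (α : F ⟶ G) (x : X.based.obj) : F.toBased.obj x ⟶ G.toBased.obj x :=
  BasedNatTrans.toNatTrans α |>.app x

theorem app_naturality {F G : X ⟶ Y} (α : F ⟶ G) {x y : X.based.obj} (f : x ⟶ y) :
    F.toBased.map f ≫ app α y = app α x ≫ G.toBased.map f :=
  BasedNatTrans.toNatTrans α |>.naturality f

theorem isHomLift_app {F G : X ⟶ Y} (α : F ⟶ G) (x : X.based.obj) :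
    Y.based.p.IsHomLift (𝟙 (Y.based.p.obj (F.toBased.obj x))) (app α x) := by
  rw [F.toBased.w_obj]
  exact BasedNatTrans.isHomLift' α x

theorem isHomLift_app' {F G : X ⟶ Y} (α : F ⟶ G) (x : X.based.obj) :
    Y.based.p.IsHomLift (𝟙 (X.based.p.obj x)) (app α x) :=
  BasedNatTrans.isHomLift' α x

theorem cell_ext {F G : X ⟶ Y} {α β : F ⟶ G} (h : ∀ x, app α x = app β x) : α = β :=
  BasedNatTrans.ext _ _ (NatTrans.ext (funext h))

/-- A 2-cell from its components. -/
def mkCell {F G : X ⟶ Y} (θ : ∀ x, F.toBased.obj x ⟶ G.toBased.obj x)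
    (naturality : ∀ {x y} (f : x ⟶ y), F.toBased.map f ≫ θ y = θ x ≫ G.toBased.map f)
    (hθ : ∀ x, Y.based.p.IsHomLift (𝟙 (X.based.p.obj x)) (θ x)) : F ⟶ G where
  toNatTrans := { app := θ, naturality := fun _ _ f => naturality f }
  isHomLift' := hθ

theorem app_comp {F G H : X ⟶ Y} (α : F ⟶ G) (β : G ⟶ H) (x : X.based.obj) :
    app (α ≫ β) x = app α x ≫ app β x := rfl

theorem app_id (F : X ⟶ Y) (x : X.based.obj) : app (𝟙 F) x = 𝟙 _ := rfl

theorem app_eqToHom {F G : X ⟶ Y} (h : F = G) (x : X.based.obj) :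
    app (eqToHom h) x = eqToHom (congrArg (fun F : X ⟶ Y => F.toBased.obj x) h) := by
  subst h; rfl

theorem isIso_app {F G : X ⟶ Y} (α : F ⟶ G) (hα : IsIso α) (x : X.based.obj) :
    IsIso (app α x) :=
  ⟨app (inv α) x, by rw [← app_comp, IsIso.hom_inv_id, app_id],
    by rw [← app_comp, IsIso.inv_hom_id, app_id]⟩

theorem isIso_of_app {F G : X ⟶ Y} (α : F ⟶ G) (h : ∀ x, IsIso (app α x)) : IsIso α := by
  refine ⟨mkCell (fun x => inv (app α x)) (fun {x y} f => ?_) (fun x => ?_), ?_, ?_⟩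
  · rw [IsIso.eq_inv_comp, ← Category.assoc, ← app_naturality, Category.assoc, IsIso.hom_inv_id,
      Category.comp_id]
  · have := isHomLift_app' α x
    exact IsHomLift.lift_id_inv_isIso Y.based.p (X.based.p.obj x) (app α x)
  · exact cell_ext fun x => IsIso.hom_inv_id (app α x)
  · exact cell_ext fun x => IsIso.inv_hom_id (app α x)

theorem isIdentityCell_iff {F G : X ⟶ Y} (α : F ⟶ G) :
    IsIdentityCell α ↔ ∀ x, ∃ h, app α x = eqToHom h := by
  constructor
  · rintro ⟨h, rfl⟩ x
    exact ⟨_, app_eqToHom h x⟩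
  · intro h
    have hFG : F = G := by
      refine functor_injective (CategoryTheory.Functor.ext (fun x => (h x).1) fun x y f => ?_)
      obtain ⟨hx, ex⟩ := h x
      obtain ⟨hy, ey⟩ := h y
      have e := app_naturality α f
      rw [ex, ey] at e
      exact ((comp_eqToHom_iff hy _ _).1 e).trans (Category.assoc _ _ _)
    exact ⟨hFG, cell_ext fun x => (h x).2.trans (app_eqToHom hFG x).symm⟩

theorem isIdentityCell_whiskerRight_iff {F G : X ⟶ Y} (α : F ⟶ G) (H : Y ⟶ Z) :
    IsIdentityCell (α ▷ H) ↔ ∀ x, (functor H).identityArrows (app α x) := by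
  rw [isIdentityCell_iff]
  refine forall_congr' fun x => ?_
  constructor
  · rintro ⟨h, e⟩
    refine IsHomLift.of_fac' _ _ _ rfl h.symm ?_
    exact e.trans (by simp; rfl)
  · intro h
    have h' : (functor H).IsHomLift (𝟙 ((functor H).obj (F.toBased.obj x))) (app α x) := h
    refine ⟨(IsHomLift.codomain_eq (functor H) (𝟙 ((functor H).obj (F.toBased.obj x)))
      (app α x)).symm, ?_⟩
    exact (IsHomLift.fac' (functor H) (𝟙 ((functor H).obj (F.toBased.obj x))) (app α x)).trans
      (by simp; rfl)

end Cells

/-! ### Stable classes of morphisms in `Fib(B)` -/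

theorem _root_.Cleavage.lift_eqToHom {X : Type*} [Category X] {p : X ⥤ B} (c : Cleavage p)
    {R S S' : B} (β : R ⟶ S) (β' : R ⟶ S') {x y : X} (hx : p.obj x = S) (hy : p.obj y = S')
    (e : x = y) {σ : S ⟶ S'} (hσ : p.IsHomLift σ (eqToHom e)) (h : β ≫ σ = β') :
    ∃ h', c.lift β x hx ≫ eqToHom e = eqToHom h' ≫ c.lift β' y hy := by
  subst e hx hy
  have hσ' : p.IsHomLift σ (𝟙 x) := hσ
  obtain rfl : σ = 𝟙 _ := (IsHomLift.eq_of_isHomLift p σ (𝟙 x)).trans (p.map_id x)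
  obtain rfl : β = β' := by simpa using h
  exact ⟨rfl, by simp⟩

/-- The vertical morphisms. -/
abbrev verticalArrows (Z : Fib.{u} B) : MorphismProperty Z.based.obj := Z.based.p.identityArrows

theorem _root_.CategoryTheory.Functor.isHomLift_id_obj {X : Type*} [Category X] {p : X ⥤ B}
    {R S : B} {β : R ⟶ S} (hS : R = S) (hβ : β = eqToHom hS) {x y : X} {w : x ⟶ y} (h : p.IsHomLift β w) :
    p.IsHomLift (𝟙 (p.obj x)) w := by
  subst hβ
  exact h.id_of_eqToHom

theorem isStable_verticalArrows (Z : Fib.{u} B) : Z.cleavage.IsStable Z.verticalArrows where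
  vertical _ h := h
  map_mem β β' _ _ hx hy w _ hw h _ :=
    isHomLift_id_obj rfl rfl (Z.cleavage.map_isHomLift β β' hx hy w hw h)

/-- The morphisms sent to identities by a 1-cell are stable under reindexing, because the 1-cell
preserves the cleavages strictly. -/
theorem isStable_identityArrows {X Y : Fib.{u} B} (F : X ⟶ Y) :
    X.cleavage.IsStable (functor F).identityArrows where
  vertical {x y} w h := by
    have h1 := h.comp_right (g := Y.based.p)
    rw [functor_comp_p] at h1
    exact isHomLift_id_obj rfl (Y.based.p.map_id _) h1
  map_mem {R S S'} β β' {x y} hx hy w σ hw h hw' := by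
    have hw1 : (functor F).IsHomLift (𝟙 ((functor F).obj x)) w := hw'
    have e := IsHomLift.codomain_eq (functor F) (𝟙 ((functor F).obj x)) w
    have ew : (functor F).map w = eqToHom e.symm :=
      (IsHomLift.fac' (functor F) (𝟙 ((functor F).obj x)) w).trans (by simp)
    have hσ : Y.based.p.IsHomLift σ ((functor F).map w) := F.toBased.preserves_isHomLift σ w
    rw [ew] at hσ
    obtain ⟨h0, e0⟩ := F.map_lift β x hx
    obtain ⟨h1, e1⟩ := F.map_lift β' y hy
    obtain ⟨h2, e2⟩ := Y.cleavage.lift_eqToHom β β' ((F.toBased.w_obj x).trans hx)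
      ((F.toBased.w_obj y).trans hy) e.symm hσ h
    have hm := X.cleavage.map_isHomLift β β' hx hy w hw h
    have hm' : Y.based.p.IsHomLift (𝟙 R) ((functor F).map (X.cleavage.map β β' hx hy w hw h)) :=
      F.toBased.preserves_isHomLift (𝟙 R) (X.cleavage.map β β' hx hy w hw h)
    have hd := X.cleavage.isStronglyCartesian β x hx
    have hd' : X.based.p.obj (X.cleavage.dom β x hx) = R :=
      IsHomLift.domain_eq X.based.p β (X.cleavage.lift β x hx)
    have key : (functor F).map (X.cleavage.map β β' hx hy w hw h) ≫ eqToHom h1 =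
        eqToHom (h0.trans h2) := by
      refine Y.cleavage.hom_ext ((F.toBased.w_obj y).trans hy) (𝟙 R) β' inferInstance ?_ ?_
      · exact IsHomLift.eqToHom_domain_lift_id (h0.trans h2) ((F.toBased.w_obj _).trans hd')
      · rw [Category.assoc, ← e1, ← (functor F).map_comp, X.cleavage.map_lift,
          (functor F).map_comp, e0, ew, Category.assoc, e2, eqToHom_trans_assoc]
    rw [comp_eqToHom_iff, eqToHom_trans] at key
    refine IsHomLift.of_fac' _ _ _ rfl ((h0.trans h2).trans h1.symm).symm ?_
    rw [key]
    simp

/-! ### The identee of a 1-cell -/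

section Identee

variable {A C : Fib.{u} B} (p : A ⟶ C)

/-- The domain of the identee of `p`: its objects are the morphisms sent to identities by `p`, and
its morphisms are the commutative squares. -/
noncomputable def identee : Fib.{u} B := CommaObj.fib (Mor.id A) (isStable_identityArrows p)

/-- The domain of the morphisms sent to identities. -/
noncomputable def identeeFst : identee p ⟶ A := CommaObj.fst (Mor.id A) (isStable_identityArrows p)

/-- The codomain of the morphisms sent to identities. -/
noncomputable def identeeSnd : identee p ⟶ A := CommaObj.snd (Mor.id A) (isStable_identityArrows p)

/-- The identee of `p`, with component `w` at a morphism `w` sent to an identity. -/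
noncomputable def identeeCell : identeeFst p ⟶ identeeSnd p :=
  mkCell (fun a => CommaObj.hom a) (fun f => CommaObj.Hom.w f)
    (fun a => CommaObj.isHomLift_hom' (isStable_identityArrows p) a rfl)

/-- A morphism sent to an identity, as an object of the identee. -/
def identeeObj {x y : A.based.obj} (w : x ⟶ y) (hw : (functor p).identityArrows w) :
    (identee p).based.obj :=
  show CommaObj (Mor.id A) (functor p).identityArrows from ⟨x, y, w, hw⟩

/-- The functor to the category of arrows of `Y` attached to a 2-cell with codomain `Y`. Being a
function of `a`, it turns equalities of 2-cells with distinct boundaries into equalities of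
functors. -/
def arrowFunctor {X Y : Fib.{u} B} (a : Arrow (X ⟶ Y)) : X.based.obj ⥤ Arrow Y.based.obj where
  obj x := Arrow.mk (app a.hom x)
  map f := Arrow.homMk (a.left.toBased.map f) (a.right.toBased.map f) (app_naturality a.hom f)
  map_id x := by ext <;> simp
  map_comp f g := by ext <;> simp

theorem CommaObj.eq_conj {X Z : Fib.{u} B} {F : Mor X Z} {P : MorphismProperty Z.based.obj}
    {a b c d : CommaObj F P} {f : a ⟶ d} {g : b ⟶ c} (h : a = b) (h' : c = d)
    (hl : f.left = eqToHom (congrArg CommaObj.left h) ≫ g.left ≫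
      eqToHom (congrArg CommaObj.left h'))
    (hr : f.right = eqToHom (congrArg CommaObj.right h) ≫ g.right ≫
      eqToHom (congrArg CommaObj.right h')) :
    f = eqToHom h ≫ g ≫ eqToHom h' := by
  subst h h'
  exact CommaObj.hom_ext hl hr

theorem arrow_conj_left {X : Type*} [Category X] {a b c d : Arrow X} {f : a ⟶ d} {g : b ⟶ c}
    {h : a = b} {h' : c = d} (e : f = eqToHom h ≫ g ≫ eqToHom h') :
    f.left = eqToHom (congrArg (·.left) h) ≫ g.left ≫ eqToHom (congrArg (·.left) h') := by
  subst h h' e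
  rfl

theorem arrow_conj_right {X : Type*} [Category X] {a b c d : Arrow X} {f : a ⟶ d} {g : b ⟶ c}
    {h : a = b} {h' : c = d} (e : f = eqToHom h ≫ g ≫ eqToHom h') :
    f.right = eqToHom (congrArg (·.right) h) ≫ g.right ≫ eqToHom (congrArg (·.right) h') := by
  subst h h' e
  rfl

theorem ext_of_whiskerLeft_identeeCell {X : Fib.{u} B} {s t : X ⟶ identee p}
    (h : Arrow.mk (s ◁ identeeCell p) = Arrow.mk (t ◁ identeeCell p)) : s = t := by
  have e := congrArg arrowFunctor h
  have e1 : ∀ x, (functor s).obj x = (functor t).obj x := fun x => by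
    have e2 : Arrow.mk (CommaObj.hom ((functor s).obj x)) =
      Arrow.mk (CommaObj.hom ((functor t).obj x)) := Functor.congr_obj e x
    obtain ⟨h1, h2, h3⟩ := Arrow.mk_eq_mk_iff _ _ |>.1 e2
    exact CommaObj.ext' h1 h2 h3
  refine functor_injective (CategoryTheory.Functor.ext e1 fun x y f => ?_)
  have e2 := Functor.congr_hom e f
  exact CommaObj.eq_conj (e1 x) (e1 y).symm (arrow_conj_left e2) (arrow_conj_right e2)

theorem isIdentee : IsIdentee p (identeeCell p) where
  isIdentity := (isIdentityCell_whiskerRight_iff _ _).2 fun a => CommaObj.mem a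
  one_dim X a₀ a₁ α hα := by
    rw [isIdentityCell_whiskerRight_iff] at hα
    refine ⟨CommaObj.lift (F := 𝟙 A) (isStable_identityArrows p) a₀ a₁ (app α)
      (app_naturality α) hα, rfl, fun t ht => ext_of_whiskerLeft_identeeCell p (ht.trans rfl)⟩
  two_dim X s t ξ₀ ξ₁ h := by
    refine ⟨mkCell (fun x => ⟨app ξ₀ x, app ξ₁ x, congrArg (app · x) h⟩) (fun f => ?_)
      (fun x => ?_), ⟨rfl, rfl⟩, ?_⟩
    · exact CommaObj.hom_ext (app_naturality ξ₀ f) (app_naturality ξ₁ f)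
    · exact (isHomLift_comp_iff _ _).2 (isHomLift_app' ξ₀ x)
    · rintro θ ⟨rfl, rfl⟩
      rfl

end Identee

end Fib

/-! ### The coinverter of the identee -/

namespace Fib

open CategoryTheory.Functor Bicategory TwoCategory

variable {B : Type u₁} [Category.{v₁} B]

section Quotient

variable {A C : Fib.{u} B} (p : A ⟶ C)

/-- The functor to `B` of the localization of `A` at the morphisms sent to identities by `p`. -/
noncomputable def coinverterProj : (functor p).identityArrows.Localization ⥤ B :=
  Localization.Construction.lift A.based.p (isStable_identityArrows p).inverts

theorem Q_comp_coinverterProj : (functor p).identityArrows.Q ⋙ coinverterProj p = A.based.p :=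
  Localization.Construction.fac _ _

/-- The coinverter of the identee of `p`: the localization of `A` at the morphisms sent to
identities by `p`, which has the same objects as `A`. The chosen lifts are the images of those of
`A`. -/
noncomputable def coinverter : Fib.{u} B where
  based := BasedCategory.ofFunctor (coinverterProj p)
  cleavage :=
    { dom := fun β X hX => (functor p).identityArrows.Q.obj (A.cleavage.dom β
        ((Localization.Construction.objEquiv (functor p).identityArrows).symm X) hX)
      lift := fun β X hX => (functor p).identityArrows.Q.map (A.cleavage.lift β
        ((Localization.Construction.objEquiv (functor p).identityArrows).symm X) hX)
      isStronglyCartesian := fun β X hX =>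
        Localization.isStronglyCartesian_Q_map (isStable_identityArrows p)
          (Q_comp_coinverterProj p) (A.cleavage.isStronglyCartesian β
            ((Localization.Construction.objEquiv (functor p).identityArrows).symm X) hX) }

/-- The localization functor, as a 1-cell. -/
noncomputable def toCoinverter : A ⟶ coinverter p where
  toBased := { toFunctor := (functor p).identityArrows.Q, w := Q_comp_coinverterProj p }
  preserves _ _ _ _ _ := rfl

variable {p} in
/-- The 1-cell out of the coinverter induced by a 1-cell inverting the morphisms sent to identities
by `p`. -/
noncomputable def coinverterDesc {X : Fib.{u} B} (f : A ⟶ X)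
    (hf : (functor p).identityArrows.IsInvertedBy (functor f)) : coinverter p ⟶ X where
  toBased :=
    { toFunctor := Localization.Construction.lift (functor f) hf
      w := Localization.Construction.uniq _ _
        ((congrArg (· ⋙ X.based.p) (Localization.Construction.fac (functor f) hf)).trans
          (f.toBased.w.trans (Q_comp_coinverterProj p).symm)) }
  preserves := by
    refine preservesCleavage_iff.2 fun R S β x hx => ?_
    obtain ⟨a, rfl⟩ := Localization.Q_obj_surjective _ x
    obtain ⟨h, e⟩ := f.map_lift β a hx
    refine ⟨h, ?_⟩
    refine Eq.trans ?_ e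
    have := Functor.congr_hom (Localization.Construction.fac (functor f) hf)
      (A.cleavage.lift β a hx)
    exact this.trans ((Category.id_comp _).trans (Category.comp_id _))

theorem toCoinverter_desc {X : Fib.{u} B} (f : A ⟶ X)
    (hf : (functor p).identityArrows.IsInvertedBy (functor f)) :
    toCoinverter p ≫ coinverterDesc f hf = f :=
  functor_injective (Localization.Construction.fac (functor f) hf)

theorem identityArrows_isInvertedBy : (functor p).identityArrows.IsInvertedBy (functor p) := by
  intro x y w hw
  have hw' : (functor p).IsHomLift (𝟙 ((functor p).obj x)) w := hw
  rw [IsHomLift.fac' (functor p) (𝟙 ((functor p).obj x)) w]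
  infer_instance

/-- The 1-cell out of the coinverter induced by `p`. -/
noncomputable def fromCoinverter : coinverter p ⟶ C :=
  coinverterDesc p (identityArrows_isInvertedBy p)

theorem toCoinverter_fromCoinverter : toCoinverter p ≫ fromCoinverter p = p :=
  toCoinverter_desc p p _

theorem isCoinverter : IsCoinverter (identeeCell p) (toCoinverter p) where
  isIso := isIso_of_app _ fun a =>
    (functor p).identityArrows.Q_inverts _ (CommaObj.mem a)
  one_dim X f hf := by
    have hf' : (functor p).identityArrows.IsInvertedBy (functor f) := fun x y w hw =>
      isIso_app _ hf (identeeObj p w hw)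
    refine ⟨coinverterDesc f hf', toCoinverter_desc p f hf', fun t ht => ?_⟩
    refine functor_injective (Localization.Construction.uniq _ _ ?_)
    exact congrArg functor (ht.trans (toCoinverter_desc p f hf').symm)
  two_dim X g h β := by
    let τ : functor g ⟶ functor h := Localization.Construction.natTransExtension
      (W := (functor p).identityArrows) (BasedNatTrans.toNatTrans β)
    have hτ : ∀ x, τ.app ((functor p).identityArrows.Q.obj x) = app β x :=
      Localization.Construction.NatTransExtension.app_eq _
    refine ⟨mkCell τ.app (fun f => τ.naturality f) fun x => ?_, cell_ext hτ,
      fun γ hγ => cell_ext fun x => ?_⟩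
    · obtain ⟨a, rfl⟩ := Localization.Q_obj_surjective _ x
      have := isHomLift_app' β a
      rw [← hτ] at this
      exact this
    · obtain ⟨a, rfl⟩ := Localization.Q_obj_surjective _ x
      exact (congrArg (app · a) hγ).trans (hτ a).symm

theorem isCoinverterOfIdentee : IsCoinverterOfIdentee p (toCoinverter p) :=
  ⟨_, _, _, _, isIdentee p, isCoinverter p⟩

end Quotient

end Fib

/-! ### Fibrewise opfibrations -/

namespace CategoryTheory.Functor

variable {X S : Type*} [Category X] [Category S]

/-- Opcartesian morphisms without reference to a base morphism. -/
theorem isStronglyCocartesian_map_iff (F : X ⥤ S) {x y : X} (l : x ⟶ y) :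
    F.IsStronglyCocartesian (F.map l) l ↔
      ∀ ⦃z : X⦄ (δ : F.obj y ⟶ F.obj z) (φ : x ⟶ z), F.map φ = F.map l ≫ δ →
        ∃! χ : y ⟶ z, F.map χ = δ ∧ l ≫ χ = φ := by
  have key : ∀ ⦃a b : X⦄ (f : F.obj a ⟶ F.obj b) (χ : a ⟶ b), F.IsHomLift f χ ↔ F.map χ = f :=
    fun a b f χ => ⟨fun _ => (IsHomLift.eq_of_isHomLift F f χ).symm, by rintro rfl; infer_instance⟩
  constructor
  · intro h z δ φ e
    have := (key _ φ).2 e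
    obtain ⟨χ, ⟨h1, h2⟩, h3⟩ := IsStronglyCocartesian.universal_property F (F.map l) l δ _ rfl φ
    exact ⟨χ, ⟨(key _ _).1 h1, h2⟩, fun χ' h' => h3 _ ⟨(key _ _).2 h'.1, h'.2⟩⟩
  · intro h
    refine { universal_property' := fun {z} δ φ hφ => ?_ }
    obtain ⟨χ, ⟨h1, h2⟩, h3⟩ := h δ φ ((key _ _).1 hφ)
    exact ⟨χ, ⟨(key _ _).2 h1, h2⟩, fun χ' h' => h3 _ ⟨(key _ _).1 h'.1, h'.2⟩⟩

theorem Fiber.isIso_of_isIso_val {p : X ⥤ S} {b : S} {x y : p.Fiber b} (φ : x ⟶ y)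
    (h : IsIso φ.1) : IsIso φ := by
  have := φ.2
  exact ⟨⟨CategoryTheory.inv φ.1, IsHomLift.lift_id_inv_isIso p b φ.1⟩,
    Subtype.ext (IsIso.hom_inv_id φ.1), Subtype.ext (IsIso.inv_hom_id φ.1)⟩

end CategoryTheory.Functor

namespace Fib

open CategoryTheory.Functor Bicategory TwoCategory CatOpfibration

variable {B : Type u₁} [Category.{v₁} B]

/-- Every vertical morphism out of the image of an object has an opcartesian lift along `p`. Both
fibrewise opfibrations and internal opfibrations have this property, from which the properties of
`fromCoinverter p` follow. -/
abbrev HasVerticalPushforwards {A C : Fib.{u} B} (p : A ⟶ C) : Prop :=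
  (functor p).HasVerticalPushforwards C.based.p

section

variable {A C : Fib.{u} B} (p : A ⟶ C)

theorem isIso_of_isIso_map_fromCoinverter (hp : HasVerticalPushforwards p)
    {X Y : (coinverter p).based.obj} (m : X ⟶ Y) (hm : IsIso ((functor (fromCoinverter p)).map m)) :
    IsIso m := by
  -- `functor p ⋙ C.based.p` is equal to `A.based.p`, but not definitionally
  have key : ∀ (f : A.based.obj ⥤ B) (_ : functor p ⋙ C.based.p = f) (cA : Cleavage f)
      (_ : cA.IsStable (functor p).identityArrows)
      (_ : ∀ {R S : B} (β : R ⟶ S) (a : A.based.obj) (ha : f.obj a = S),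
        C.based.p.IsStronglyCartesian β ((functor p).map (cA.lift β a ha))), IsIso m := by
    rintro _ rfl cA hW hcart
    exact Localization.isIso_of_isIso_map (Localization.Construction.fac _ _) hp cA C.cleavage hW
      hcart m hm
  exact key _ p.toBased.w A.cleavage (isStable_identityArrows p) p.isStronglyCartesian_map_lift

theorem isStronglyCocartesian_toCoinverter_map (hp : HasVerticalPushforwards p)
    {x y : A.based.obj} {e : x ⟶ y} {d d' : C.based.obj} {γ : d ⟶ d'}
    (he : (functor p).IsStronglyCocartesian γ e)
    (hγ : C.based.p.IsHomLift (𝟙 (C.based.p.obj d)) γ) :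
    (functor (fromCoinverter p)).IsStronglyCocartesian γ ((functor (toCoinverter p)).map e) := by
  have hγ' : IsIso (C.based.p.map γ) := hγ.isIso_map_iff.2 inferInstance
  have key : ∀ (f : A.based.obj ⥤ B) (_ : functor p ⋙ C.based.p = f) (cA : Cleavage f)
      (_ : cA.IsStable (functor p).identityArrows)
      (_ : ∀ {R S : B} (β : R ⟶ S) (a : A.based.obj) (ha : f.obj a = S),
        C.based.p.IsStronglyCartesian β ((functor p).map (cA.lift β a ha))),
      (functor (fromCoinverter p)).IsStronglyCocartesian γ
        ((functor (toCoinverter p)).map e) := by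
    rintro _ rfl cA hW hcart
    exact Localization.isStronglyCocartesian_Q_map (Localization.Construction.fac _ _) hp cA
      C.cleavage hW hcart he hγ'
  exact key _ p.toBased.w A.cleavage (isStable_identityArrows p) p.isStronglyCartesian_map_lift

theorem toCoinverter_obj_surjective (X : (coinverter p).based.obj) :
    ∃ x, (functor (toCoinverter p)).obj x = X :=
  Localization.Q_obj_surjective _ X

end

section Fibre

variable {A C : Fib.{u} B} (p : A ⟶ C)

theorem isHomLift_fibreMap_iff {b : B} {x y : A.based.p.Fiber b} (φ : x ⟶ y)
    {d d' : C.based.p.Fiber b} (γ : d ⟶ d') :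
    (fibreMap p b).IsHomLift γ φ ↔ (functor p).IsHomLift γ.1 φ.1 := by
  constructor
  · intro h
    obtain rfl := IsHomLift.domain_eq (fibreMap p b) γ φ
    obtain rfl := IsHomLift.codomain_eq (fibreMap p b) γ φ
    obtain rfl := IsHomLift.eq_of_isHomLift (fibreMap p b) γ φ
    exact IsHomLift.map (functor p) φ.1
  · intro h
    obtain ⟨d, hd⟩ := d
    obtain ⟨d', hd'⟩ := d'
    obtain ⟨γ, hγ⟩ := γ
    obtain rfl : (functor p).obj x.1 = d := IsHomLift.domain_eq (functor p) γ φ.1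
    obtain rfl : (functor p).obj y.1 = d' := IsHomLift.codomain_eq (functor p) γ φ.1
    obtain rfl : γ = (functor p).map φ.1 := IsHomLift.eq_of_isHomLift (functor p) γ φ.1
    exact IsHomLift.map (fibreMap p b) φ

/-- A morphism of a fibre that is opcartesian for the restriction of `p` to this fibre is
opcartesian for `p`: a morphism out of its domain, and its image, are factored into a vertical
morphism and a cartesian one, and `p` preserves cartesian morphisms. -/
theorem isStronglyCocartesian_of_fibreMap {b : B} {x y : A.based.p.Fiber b} (φ : x ⟶ y)
    (h : (fibreMap p b).IsStronglyCocartesian ((fibreMap p b).map φ) φ) :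
    (functor p).IsStronglyCocartesian ((functor p).map φ.1) φ.1 := by
  rw [isStronglyCocartesian_map_iff] at h ⊢
  obtain ⟨x, hx⟩ := x
  obtain ⟨y, hy⟩ := y
  obtain ⟨l, hl⟩ := φ
  subst hx
  intro z δ ψ e
  change ∃! χ : y ⟶ z, (functor p).map χ = δ ∧ l ≫ χ = ψ
  have hpl : C.based.p.IsHomLift (𝟙 (A.based.p.obj x)) ((functor p).map l) :=
    p.toBased.preserves_isHomLift (𝟙 (A.based.p.obj x)) l
  have hpψ : C.based.p.IsHomLift (A.based.p.map ψ) ((functor p).map ψ) :=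
    p.toBased.preserves_isHomLift _ ψ
  have hδ : C.based.p.IsHomLift (A.based.p.map ψ) δ := by
    refine isHomLift_of_square (u := (functor p).map ψ) (δ := 𝟙 _) (γ := (functor p).map l) (v := δ)
      ((Category.comp_id _).trans e) ?_ inferInstance hpψ
    exact isHomLift_id_obj ((p.toBased.w_obj x).symm.trans (p.toBased.w_obj x)) rfl hpl
  have hρ := A.cleavage.isStronglyCartesian (A.based.p.map ψ) z rfl
  have hpρ := p.isStronglyCartesian_map_lift (A.based.p.map ψ) z rfl
  set ρ := A.cleavage.lift (A.based.p.map ψ) z rfl with hρdef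
  have hdom : A.based.p.obj (A.cleavage.dom (A.based.p.map ψ) z rfl) = A.based.p.obj x :=
    IsHomLift.domain_eq A.based.p (A.based.p.map ψ) ρ
  obtain ⟨v, ⟨hv, hvρ⟩, -⟩ := IsStronglyCartesian.universal_property A.based.p (A.based.p.map ψ) ρ
    (𝟙 _) _ (Category.id_comp _).symm ψ
  obtain ⟨δ', ⟨hδ', hδρ⟩, hδu⟩ := IsStronglyCartesian.universal_property C.based.p
    (A.based.p.map ψ) ((functor p).map ρ) (𝟙 _) _ (Category.id_comp _).symm δ
  have hpv : C.based.p.IsHomLift (𝟙 (A.based.p.obj x)) ((functor p).map v) :=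
    p.toBased.preserves_isHomLift (𝟙 (A.based.p.obj x)) v
  have ev : (functor p).map v = (functor p).map l ≫ δ' := by
    refine IsStronglyCartesian.ext C.based.p (A.based.p.map ψ) ((functor p).map ρ) (𝟙 _) ?_
    rw [← (functor p).map_comp, hvρ, Category.assoc, hδρ, e]
  obtain ⟨χ, ⟨h1, h2⟩, h3⟩ := h (z := ⟨_, hdom⟩) ⟨δ', hδ'⟩ ⟨v, hv⟩ (Subtype.ext ev)
  have h1' : (functor p).map χ.1 = δ' := congrArg Subtype.val h1
  have h2' : l ≫ χ.1 = v := congrArg Subtype.val h2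
  refine ⟨χ.1 ≫ ρ, ⟨?_, ?_⟩, ?_⟩
  · rw [(functor p).map_comp, h1', hδρ]
  · rw [← Category.assoc, h2', hvρ]
  · rintro χ' ⟨rfl, hχ'⟩
    have hχ : A.based.p.IsHomLift (A.based.p.map ψ) χ' := (p.toBased.isHomLift_iff _ _).1 hδ
    obtain ⟨χ'', ⟨hχ'', e''⟩, -⟩ := IsStronglyCartesian.universal_property A.based.p
      (A.based.p.map ψ) ρ (𝟙 _) _ (Category.id_comp _).symm χ'
    have e1 : (functor p).map χ'' = δ' := by
      refine hδu _ ⟨p.toBased.preserves_isHomLift (𝟙 (A.based.p.obj x)) χ'', ?_⟩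
      rw [← (functor p).map_comp, e'']
    have e2 : l ≫ χ'' = v := by
      refine IsStronglyCartesian.ext A.based.p (A.based.p.map ψ) ρ (𝟙 _) ?_
      rw [Category.assoc, e'', hχ', hvρ]
    have e3 := h3 ⟨χ'', hχ''⟩ ⟨Subtype.ext e1, Subtype.ext e2⟩
    have e4 : χ'' = χ.1 := congrArg Subtype.val e3
    rw [← e4, e'']

theorem IsFibrewiseOpfibration.hasVerticalPushforwards {p : A ⟶ C}
    (hp : IsFibrewiseOpfibration p) : HasVerticalPushforwards p := by
  intro x d γ hγ
  have hx : A.based.p.obj x = C.based.p.obj ((functor p).obj x) := (p.toBased.w_obj x).symm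
  have hd : C.based.p.obj d = C.based.p.obj ((functor p).obj x) :=
    IsHomLift.codomain_eq C.based.p (𝟙 (C.based.p.obj ((functor p).obj x))) γ
  obtain ⟨y, φ, hφ⟩ := hp (C.based.p.obj ((functor p).obj x)) ⟨x, hx⟩ ⟨d, hd⟩ ⟨γ, hγ⟩
  have h1 := (isHomLift_fibreMap_iff p _ _).1 hφ.toIsHomLift
  refine ⟨y.1, φ.1, (isStronglyCocartesian_of_fibreMap p φ ?_).congr_base h1⟩
  exact hφ.congr_base (.map φ)

theorem isStronglyCocartesian_fibreMap {b : B} {x y : A.based.p.Fiber b} (φ : x ⟶ y)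
    (h : (functor p).IsStronglyCocartesian ((functor p).map φ.1) φ.1) :
    (fibreMap p b).IsStronglyCocartesian ((fibreMap p b).map φ) φ := by
  rw [isStronglyCocartesian_map_iff] at h ⊢
  intro z δ ψ e
  obtain ⟨χ, ⟨h1, h2⟩, h3⟩ := h δ.1 ψ.1 (congrArg Subtype.val e)
  have hχ : A.based.p.IsHomLift (𝟙 b) χ := by
    have h1' : p.toBased.map χ = δ.1 := h1
    rw [← p.toBased.isHomLift_iff, h1']
    exact δ.2
  refine ⟨⟨χ, hχ⟩, ⟨Subtype.ext h1, Subtype.ext h2⟩, fun χ' h' => Subtype.ext ?_⟩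
  exact h3 _ ⟨congrArg Subtype.val h'.1, congrArg Subtype.val h'.2⟩

theorem isFibrewiseOpfibrationInGroupoids_fromCoinverter (hp : HasVerticalPushforwards p) :
    IsFibrewiseOpfibrationInGroupoids (fromCoinverter p) := by
  refine fun b => ⟨fun X d β => ?_, fun d X Y φ => ?_⟩
  · obtain ⟨X, hX⟩ := X
    obtain ⟨x, rfl⟩ := toCoinverter_obj_surjective p X
    obtain ⟨d, hd⟩ := d
    obtain ⟨γ, hγ⟩ := β
    have hγ' : C.based.p.IsHomLift (𝟙 (C.based.p.obj ((functor p).obj x))) γ :=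
      isHomLift_id_obj rfl rfl hγ
    obtain ⟨y, l, hl⟩ := hp x d γ hγ'
    have hc := isStronglyCocartesian_toCoinverter_map p hp hl hγ'
    have hl2 : (coinverter p).based.p.IsHomLift (𝟙 b) ((functor (toCoinverter p)).map l) := by
      rw [← (fromCoinverter p).toBased.isHomLift_iff]
      exact (isHomLift_comp_iff _ _).1 (hc.toIsHomLift.comp_right_iff.2 hγ)
    let φ : (Fiber.mk hX : (coinverter p).based.p.Fiber b) ⟶
        Fiber.mk (IsHomLift.codomain_eq (coinverter p).based.p (𝟙 b)
          ((functor (toCoinverter p)).map l)) := ⟨_, hl2⟩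
    refine ⟨_, φ, ?_⟩
    refine (isStronglyCocartesian_fibreMap (fromCoinverter p) φ ?_).congr_base ?_
    · exact hc.congr_base (.map φ.1)
    · exact (isHomLift_fibreMap_iff (fromCoinverter p) φ _).2 hc.toIsHomLift
  · have hφ := φ.2
    refine Fiber.isIso_of_isIso_val φ (Fiber.isIso_of_isIso_val φ.1 ?_)
    refine isIso_of_isIso_map_fromCoinverter p hp _ ?_
    have h1 : IsIso ((fibreMap (fromCoinverter p) b).map φ.1) :=
      hφ.isIso_map_iff.2 inferInstance
    exact inferInstanceAs (IsIso (Fiber.fiberInclusion.map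
      ((fibreMap (fromCoinverter p) b).map φ.1)))

end Fibre

end Fib

/-! ### Internal opfibrations have pushforwards along vertical morphisms -/

namespace CategoryTheory.Functor

/-- A natural transformation with opcartesian components is opcartesian. -/
theorem isStronglyCocartesian_whiskeringRight {X S T : Type*} [Category X] [Category S]
    [Category T] (F : X ⥤ S) {h k : T ⥤ X}
    (α : h ⟶ k) (hα : ∀ t, F.IsStronglyCocartesian (F.map (α.app t)) (α.app t)) :
    ((whiskeringRight T X S).obj F).IsStronglyCocartesian
      (((whiskeringRight T X S).obj F).map α) α := by
  simp only [isStronglyCocartesian_map_iff] at hα ⊢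
  intro l δ ψ e
  have e' : ∀ t, F.map (ψ.app t) = F.map (α.app t) ≫ δ.app t := fun t => NatTrans.congr_app e t
  choose χ hχ hχ' using fun t => hα t (δ.app t) (ψ.app t) (e' t)
  refine ⟨{ app := χ, naturality := fun t t' f => ?_ }, ⟨?_, ?_⟩, ?_⟩
  · refine (hα t (F.map (k.map f) ≫ δ.app t') (ψ.app t ≫ l.map f) ?_).unique ⟨?_, ?_⟩ ⟨?_, ?_⟩
    · rw [← ψ.naturality, F.map_comp, e', ← reassoc_of% (F.map_comp (α.app t)), ← α.naturality,
        F.map_comp, Category.assoc]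
    · rw [F.map_comp, (hχ t').1]
    · rw [← Category.assoc, ← α.naturality, Category.assoc, (hχ t').2, ψ.naturality]
    · rw [F.map_comp, (hχ t).1]
      exact (δ.naturality f).symm
    · rw [← Category.assoc, (hχ t).2]
  · ext t
    exact (hχ t).1
  · ext t
    exact (hχ t).2
  · rintro χ' ⟨h1, h2⟩
    ext t
    exact hχ' t _ ⟨NatTrans.congr_app h1 t, NatTrans.congr_app h2 t⟩

end CategoryTheory.Functor

namespace Fib

open CategoryTheory.Functor Bicategory TwoCategory CatOpfibration

variable {B : Type u₁} [Category.{v₁} B]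

section Postcomp

variable {T A C : Fib.{u} B} {p : A ⟶ C}

theorem isHomLift_app_of_postcomp {a b : T ⟶ C} {θ : a ⟶ b} {h k : T ⟶ A} {α : h ⟶ k}
    (hα : (postcomp T p).IsHomLift θ α) (t : T.based.obj) :
    (functor p).IsHomLift (app θ t) (app α t) := by
  obtain rfl := hα.obj_domain
  obtain rfl := hα.obj_codomain
  obtain rfl := hα.eq_map
  exact IsHomLift.map (functor p) (app α t)

theorem isHomLift_postcomp {a b : T ⟶ C} {θ : a ⟶ b} {h k : T ⟶ A} {α : h ⟶ k}
    (ha : h ≫ p = a) (hb : k ≫ p = b)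
    (hα : ∀ t, (functor p).IsHomLift (app θ t) (app α t)) :
    (postcomp T p).IsHomLift θ α := by
  subst ha hb
  obtain rfl : θ = α ▷ p := cell_ext fun t => (hα t).eq_map
  exact IsHomLift.map (postcomp T p) α

/-- A 2-cell with opcartesian components is opcartesian. -/
theorem isOpcartesian_postcomp {h k : T ⟶ A} (α : h ⟶ k)
    (hα : ∀ t, IsOpcartesian (functor p) (app α t)) : IsOpcartesian (postcomp T p) α := by
  refine (isStronglyCocartesian_map_iff _ _).2 fun l δ ψ e => ?_
  have h1 := (isStronglyCocartesian_map_iff _ _).1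
    (isStronglyCocartesian_whiskeringRight (functor p) (BasedNatTrans.toNatTrans α) hα)
  obtain ⟨χ, ⟨h2, h3⟩, h4⟩ := h1 (z := functor l) (BasedNatTrans.toNatTrans δ)
    (BasedNatTrans.toNatTrans ψ) (congrArg BasedNatTrans.toNatTrans e)
  have h5 : ∀ t, (functor p).map (χ.app t) = app δ t := fun t => NatTrans.congr_app h2 t
  refine ⟨mkCell χ.app (fun f => χ.naturality f) (fun t => ?_), ⟨cell_ext h5,
    cell_ext fun t => NatTrans.congr_app h3 t⟩, ?_⟩
  · rw [← p.toBased.isHomLift_iff]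
    have h6 := isHomLift_app' δ t
    rw [← h5] at h6
    exact h6
  · rintro χ' ⟨h6, h7⟩
    have h8 := h4 (BasedNatTrans.toNatTrans χ')
      ⟨congrArg BasedNatTrans.toNatTrans h6, congrArg BasedNatTrans.toNatTrans h7⟩
    exact cell_ext fun t => NatTrans.congr_app h8 t

end Postcomp

section Internal

variable {A C : Fib.{u} B}

/-- The identity at the image of an object, as an object of the comma object. -/
def CommaObj.identity (p : A ⟶ C) (z : A.based.obj) : CommaObj p C.verticalArrows :=
  ⟨z, (functor p).obj z, 𝟙 _, IsHomLift.id rfl⟩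

variable {p : A ⟶ C}

/-- A functorial choice `lam e` of lifts of the vertical morphisms `e.hom` consists of opcartesian
morphisms if the chosen lifts of identities are invertible and `L` sends `(lam e, 1)` to the chosen
lift of the identity: the factorization of a morphism `ψ` over `e.hom ≫ g` through `lam e` is
`L (ψ, g)`, followed by the inverse of the chosen lift of an identity. -/
theorem CommaObj.isStronglyCocartesian_of_pushforward
    (L : CommaObj p C.verticalArrows ⥤ A.based.obj) (lam : fstFunctor p C.verticalArrows ⟶ L)
    (hlam : ∀ e, (functor p).IsHomLift e.hom (lam.app e))
    (hL : ∀ {e e' : CommaObj p C.verticalArrows} (f : e ⟶ e'),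
      (functor p).IsHomLift f.right (L.map f))
    (hiso : ∀ z, IsIso (lam.app (identity p z)))
    (hm : ∀ e (m : e ⟶ identity p (L.obj e)), m.left = lam.app e →
      m.right = eqToHom (hlam e).obj_codomain.symm → L.map m = lam.app (identity p (L.obj e)))
    (e : CommaObj p C.verticalArrows) : (functor p).IsStronglyCocartesian e.hom (lam.app e) := by
  refine { toIsHomLift := hlam e, universal_property' := fun {z} g ψ hψ => ?_ }
  have eψ : e.hom ≫ g = (functor p).map ψ := hψ.eq_map
  let f : e ⟶ identity p z := ⟨ψ, g, (Category.comp_id _).trans eψ.symm⟩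
  have hf : (functor p).IsHomLift g (L.map f) := hL f
  let κ : ∀ z, z ⟶ L.obj (identity p z) := fun z => lam.app (identity p z)
  have hz : (functor p).IsHomLift (𝟙 ((functor p).obj z)) (κ z) := hlam (identity p z)
  have hzi : IsIso (κ z) := hiso z
  have hzi' := IsHomLift.lift_id_inv_isIso (functor p) ((functor p).obj z) (κ z)
  refine ⟨L.map f ≫ CategoryTheory.inv (κ z), ⟨?_, ?_⟩, ?_⟩
  · exact IsHomLift.comp_lift_id_right (p := functor p) g (L.map f) _
  · have h1 : ψ ≫ κ z = lam.app e ≫ L.map f := lam.naturality f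
    rw [← Category.assoc, ← h1, Category.assoc, IsIso.hom_inv_id, Category.comp_id]
  · rintro χ ⟨hχ, rfl⟩
    have hd := (hlam e).obj_codomain
    have e1 : (functor p).map (lam.app e) ≫ 𝟙 _ = e.hom ≫ eqToHom hd.symm := by
      rw [(hlam e).map_eq]
      exact (Category.comp_id _).trans (Category.id_comp _)
    have e2 : (functor p).map χ ≫ 𝟙 _ = 𝟙 _ ≫ eqToHom hd ≫ g := by
      rw [hχ.map_eq]
      simp
    -- `f` is the composite of `m` and `n`, and the image of `m` is known
    let m : e ⟶ identity p (L.obj e) := ⟨lam.app e, eqToHom hd.symm, e1⟩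
    let n : identity p (L.obj e) ⟶ identity p z := ⟨χ, eqToHom hd ≫ g, e2⟩
    have hmn : f = m ≫ n := by
      refine hom_ext rfl ?_
      change g = eqToHom hd.symm ≫ eqToHom hd ≫ g
      simp
    have h2 : χ ≫ κ z = κ (L.obj e) ≫ L.map n := lam.naturality n
    have h3 : L.map m = κ (L.obj e) := hm e m rfl rfl
    rw [IsIso.eq_comp_inv, h2, hmn, L.map_comp, h3]

/-- An internal opfibration has a universal pushforward 1-cell, the codomain of an opcartesian lift
of the universal vertical 2-cell out of `p`. Its components are opcartesian: the assumption that
opcartesian 2-cells are stable under precomposition gives the invertibility of the lifts of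
identities, and the uniqueness in the universal property of the opcartesian 2-cell the value of `L`
on the canonical morphisms `m`. -/
theorem _root_.TwoCategory.IsInternalOpfibration.exists_pushforward
    (hp : IsInternalOpfibration p) :
    ∃ (L : CommaObj.fib p (isStable_verticalArrows C) ⟶ A)
      (lam : CommaObj.fst p (isStable_verticalArrows C) ⟶ L),
      ∀ e : CommaObj p C.verticalArrows, (functor p).IsStronglyCocartesian e.hom (app lam e) := by
  obtain ⟨L, lam, hlam⟩ := hp.isOpfibration _ _ _ (CommaObj.cell p (isStable_verticalArrows C))
  have hL : L ≫ p = CommaObj.snd p (isStable_verticalArrows C) := hlam.toIsHomLift.obj_codomain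
  have hlam1 : ∀ e : CommaObj p C.verticalArrows, (functor p).IsHomLift e.hom (app lam e) :=
    fun e => isHomLift_app_of_postcomp hlam.toIsHomLift e
  have hLmap : ∀ {e e' : CommaObj p C.verticalArrows} (f : e ⟶ e'),
      (functor p).IsHomLift f.right ((functor L).map f) := fun {e e'} f => by
    have h1 : ∀ (k : CommaObj.fib p (isStable_verticalArrows C) ⟶ C), L ≫ p = k →
        (functor p).IsHomLift ((functor k).map f) ((functor L).map f) := by
      rintro _ rfl
      exact IsHomLift.map (functor p) _
    exact h1 _ hL
  -- the section of the first projection which picks out the identities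
  let η : A ⟶ CommaObj.fib p (isStable_verticalArrows C) :=
    CommaObj.lift (F := p) (isStable_verticalArrows C) (𝟙 A) p (fun x => 𝟙 _)
      (fun f => (Category.comp_id _).trans (Category.id_comp _).symm)
      (fun x => IsHomLift.id rfl)
  have hη : ∀ z, (functor p).IsHomLift (𝟙 ((functor p).obj z)) (app (η ◁ lam) z) :=
    fun z => hlam1 (CommaObj.identity p z)
  refine ⟨L, lam, CommaObj.isStronglyCocartesian_of_pushforward (functor L)
    (BasedNatTrans.toNatTrans lam) hlam1 hLmap (fun z => ?_) (fun e m hml hmr => ?_)⟩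
  · have h1 : IsOpcartesian (postcomp _ p) (η ◁ lam) :=
      hp.preserves _ _ η _ _ lam (hlam.congr_base (.map lam))
    have h2 : IsIso ((postcomp A p).map (η ◁ lam)) :=
      isIso_of_app _ fun z => (hη z).isIso_map_iff.2 inferInstance
    have h3 : IsIso (η ◁ lam) :=
      @IsStronglyCocartesian.isIso_of_base_isIso _ _ _ _ (postcomp A p) _ _ _ _ _ _ h1 h2
    exact isIso_app _ h3 z
  · have hnat : ∀ {e e' : CommaObj p C.verticalArrows} (f : e ⟶ e'),
        f.right ≫ eqToHom (hlam1 e').obj_codomain.symm =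
          eqToHom (hlam1 e).obj_codomain.symm ≫ (functor p).map ((functor L).map f) :=
      fun f => by
        rw [(hLmap f).map_eq, eqToHom_trans_assoc, eqToHom_refl, Category.id_comp]
    let M : 𝟙 _ ⟶ L ≫ η := mkCell
      (fun e : CommaObj p C.verticalArrows => (⟨app lam e, eqToHom (hlam1 e).obj_codomain.symm,
        (Category.comp_id _).trans ((hlam1 e).map_eq.trans (Category.id_comp _))⟩ :
          e ⟶ CommaObj.identity p ((functor L).obj e)))
      (fun f => CommaObj.hom_ext (app_naturality lam f) (hnat f))
      (fun e => (isHomLift_comp_iff _ _).2 (isHomLift_app' lam e))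
    have hM : m = app M e := CommaObj.hom_ext hml hmr
    have h1 : M ▷ L = (L ≫ η) ◁ lam := by
      have h2 := (isStronglyCocartesian_map_iff (postcomp _ p) lam).1 (hlam.congr_base (.map lam))
      refine (h2 (((L ≫ η) ◁ lam) ▷ p) (lam ≫ (L ≫ η) ◁ lam) ?_).unique ⟨?_, ?_⟩ ⟨rfl, rfl⟩
      · exact (postcomp _ p).map_comp _ _
      · refine cell_ext fun e => ?_
        have h3 : (functor p).IsHomLift (eqToHom (hlam1 e).obj_codomain.symm)
          ((functor L).map (app M e)) := hLmap (app M e)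
        have h4 : (functor p).IsHomLift (eqToHom rfl) (app (η ◁ lam) ((functor L).obj e)) :=
          hη ((functor L).obj e)
        exact h3.map_eq_eqToHom.trans h4.map_eq_eqToHom.symm
      · exact cell_ext fun e => (app_naturality lam (app M e)).symm
    rw [hM]
    exact congrArg (app · e) h1

theorem _root_.TwoCategory.IsInternalOpfibration.hasVerticalPushforwards
    (hp : IsInternalOpfibration p) : HasVerticalPushforwards p := by
  obtain ⟨L, lam, h⟩ := hp.exists_pushforward
  exact fun x d γ hγ => ⟨_, _, h ⟨x, d, γ, hγ⟩⟩

end Internal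

end Fib

/-! ### Internal opfibrations in groupoids -/

namespace Fib

open CategoryTheory.Functor Bicategory TwoCategory CatOpfibration

variable {B : Type u₁} [Category.{v₁} B]

theorem _root_.CategoryTheory.Functor.comp_eq_of_isHomLift {E Q C : Type*} [Category E] [Category Q]
    [Category C] {G : E ⥤ Q} {s : Q ⥤ C} {K : E ⥤ C} (ho : ∀ x, s.obj (G.obj x) = K.obj x)
    (h : ∀ {x y : E} (f : x ⟶ y), s.IsHomLift (K.map f) (G.map f)) : G ⋙ s = K :=
  CategoryTheory.Functor.ext ho fun _ _ f => (h f).map_eq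

section Pushforward

variable {Q C : Fib.{u} B} (s : Q ⟶ C)

theorem isHomLift_lift {R S : B} (β : R ⟶ S) (y : Q.based.obj) (hy : Q.based.p.obj y = S)
    {d : C.based.obj} (hd : (functor s).obj y = d) (hd' : C.based.p.obj d = S) :
    (functor s).IsHomLift (C.cleavage.lift β d hd') (Q.cleavage.lift β y hy) := by
  subst hd
  obtain ⟨h, e⟩ := s.map_lift β y hy
  refine IsHomLift.of_fac' _ _ _ h rfl (e.trans ?_)
  exact congrArg _ (Category.comp_id _).symm

/-- A choice of pushforwards along vertical morphisms that commutes strictly with the chosen lifts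
of the morphisms of `B`. -/
structure CleavedPushforward where
  /-- the pushforward -/
  obj : CommaObj s C.verticalArrows → Q.based.obj
  /-- the opcartesian morphism to the pushforward -/
  arrow : ∀ e, e.left ⟶ obj e
  isStronglyCocartesian : ∀ e, (functor s).IsStronglyCocartesian e.hom (arrow e)
  reindex : ∀ {R S : B} (β : R ⟶ S) (e : CommaObj s C.verticalArrows)
    (he : Q.based.p.obj e.left = S) (he' : Q.based.p.obj (obj e) = S),
    ∃ h : obj (e.reindex (isStable_verticalArrows C) β he) = Q.cleavage.dom β (obj e) he',
      arrow (e.reindex (isStable_verticalArrows C) β he) ≫ eqToHom h ≫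
        Q.cleavage.lift β (obj e) he' = Q.cleavage.lift β e.left he ≫ arrow e

namespace CleavedPushforward

variable {s} (P : CleavedPushforward s)

theorem exists_map {e e' : CommaObj s C.verticalArrows} (f : e ⟶ e') :
    ∃! m : P.obj e ⟶ P.obj e', (functor s).IsHomLift f.right m ∧
      P.arrow e ≫ m = f.left ≫ P.arrow e' := by
  have h1 := P.isStronglyCocartesian e
  have h2 := P.isStronglyCocartesian e'
  have h3 : (functor s).IsHomLift (e.hom ≫ f.right) (f.left ≫ P.arrow e') := by
    rw [← f.w]
    exact IsHomLift.comp (functor s) ((functor s).map f.left) e'.hom f.left (P.arrow e')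
  exact IsStronglyCocartesian.universal_property (functor s) e.hom (P.arrow e) f.right _ rfl
    (f.left ≫ P.arrow e')

theorem obj_arrow (e : CommaObj s C.verticalArrows) :
    (functor s).obj (P.obj e) = e.right := (P.isStronglyCocartesian e).toIsHomLift.obj_codomain

theorem p_obj (e : CommaObj s C.verticalArrows) {S : B} (he : Q.based.p.obj e.left = S) :
    Q.based.p.obj (P.obj e) = S := by
  rw [← s.toBased.w_obj, P.obj_arrow]
  exact CommaObj.obj_right (isStable_verticalArrows C) e he

theorem isHomLift_arrow (e : CommaObj s C.verticalArrows) {S : B}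
    (he : Q.based.p.obj e.left = S) : Q.based.p.IsHomLift (𝟙 S) (P.arrow e) := by
  rw [← s.toBased.isHomLift_iff]
  exact (isHomLift_comp_iff (Fib.functor s) C.based.p).1
    ((P.isStronglyCocartesian e).toIsHomLift.comp_right_iff.2
      (CommaObj.isHomLift_hom' (isStable_verticalArrows C) e he))

/-- The pushforward functor. -/
noncomputable def functor : CommaObj s C.verticalArrows ⥤ Q.based.obj where
  obj := P.obj
  map f := (P.exists_map f).choose
  map_id e := ((P.exists_map (𝟙 e)).choose_spec.2 (𝟙 _) ⟨IsHomLift.id (P.obj_arrow e),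
    (Category.comp_id _).trans (Category.id_comp _).symm⟩).symm
  map_comp f g := by
    have h1 := (P.exists_map f).choose_spec.1
    have h2 := (P.exists_map g).choose_spec.1
    refine ((P.exists_map (f ≫ g)).choose_spec.2 _ ⟨?_, ?_⟩).symm
    · have := h1.1
      have := h2.1
      exact IsHomLift.comp (Fib.functor s) f.right g.right _ _
    · rw [← Category.assoc, h1.2, Category.assoc, h2.2]
      exact (Category.assoc _ _ _).symm

theorem isHomLift_map {e e' : CommaObj s C.verticalArrows} (f : e ⟶ e') :
    (Fib.functor s).IsHomLift f.right (P.functor.map f) := (P.exists_map f).choose_spec.1.1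

theorem arrow_map {e e' : CommaObj s C.verticalArrows} (f : e ⟶ e') :
    P.arrow e ≫ P.functor.map f = f.left ≫ P.arrow e' := (P.exists_map f).choose_spec.1.2

theorem map_eq {e e' : CommaObj s C.verticalArrows} (f : e ⟶ e') (m : P.obj e ⟶ P.obj e')
    (h : (Fib.functor s).IsHomLift f.right m) (h' : P.arrow e ≫ m = f.left ≫ P.arrow e') :
    P.functor.map f = m := ((P.exists_map f).choose_spec.2 m ⟨h, h'⟩).symm

theorem functor_comp : P.functor ⋙ Fib.functor s = CommaObj.sndFunctor s C.verticalArrows :=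
  comp_eq_of_isHomLift P.obj_arrow P.isHomLift_map

/-- The pushforward functor, as a 1-cell. -/
noncomputable def mor : CommaObj.fib s (isStable_verticalArrows C) ⟶ Q where
  toBased :=
    { toFunctor := P.functor
      w := by
        rw [← functor_comp_p s]
        refine (congrArg (· ⋙ C.based.p) P.functor_comp).trans ?_
        exact (CommaObj.snd s (isStable_verticalArrows C)).toBased.w }
  preserves := by
    refine preservesCleavage_iff.2 fun R S β e he => ?_
    obtain ⟨h, e1⟩ := P.reindex β e he (P.p_obj e he)
    refine ⟨h, P.map_eq (CommaObj.reindexLift (isStable_verticalArrows C) β e he) _ ?_ e1⟩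
    have := isHomLift_lift s β (P.obj e) (P.p_obj e he) (P.obj_arrow e)
      (CommaObj.obj_right (isStable_verticalArrows C) e he)
    exact (IsHomLift.comp_eqToHom_lift_iff (p := Fib.functor s) _ _ h).2 this

/-- The opcartesian morphisms to the pushforwards, as a 2-cell. -/
noncomputable def cell : CommaObj.fst s (isStable_verticalArrows C) ⟶ P.mor :=
  mkCell P.arrow (fun f => (P.arrow_map f).symm) (fun e => P.isHomLift_arrow e rfl)

theorem mor_comp : P.mor ≫ s = CommaObj.snd s (isStable_verticalArrows C) :=
  functor_injective P.functor_comp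

end CleavedPushforward

/-- If all vertical morphisms are opcartesian, then so are all 2-cells, and the stability of
opcartesian 2-cells under precomposition is automatic. A lift of an arbitrary 2-cell is obtained
from the pushforward 1-cell by the universal property of the comma object. -/
theorem isInternalOpfibration_of_cleavedPushforward (P : CleavedPushforward s)
    (hs : ∀ {X Y : Q.based.obj} (m : X ⟶ Y), Q.based.p.IsHomLift (𝟙 (Q.based.p.obj X)) m →
      IsOpcartesian (functor s) m) : IsInternalOpfibration s := by
  have hcell : ∀ {T : Fib.{u} B} {h k : T ⟶ Q} (α : h ⟶ k), IsOpcartesian (postcomp T s) α :=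
    fun α => isOpcartesian_postcomp α fun t => hs _ (isHomLift_app α t)
  refine ⟨fun T h k θ => ?_, fun X Y g a₀ a₁ α _ => hcell _⟩
  let t : T ⟶ CommaObj.fib s (isStable_verticalArrows C) :=
    CommaObj.lift (F := s) (isStable_verticalArrows C) h k (app θ) (app_naturality θ)
      (isHomLift_app θ)
  refine ⟨t ≫ P.mor, t ◁ P.cell, (hcell (t ◁ P.cell)).congr_base ?_⟩
  exact isHomLift_postcomp rfl (congrArg (t ≫ ·) P.mor_comp) fun x =>
    (P.isStronglyCocartesian ((functor t).obj x)).toIsHomLift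

end Pushforward

section Coinverter

variable {A C : Fib.{u} B} {p : A ⟶ C}

/-- Every vertical morphism of the coinverter is opcartesian: it differs from the image of an
opcartesian morphism of `A` by a morphism sent to an identity, which is invertible by
conservativity. -/
theorem isOpcartesian_fromCoinverter (hp : HasVerticalPushforwards p)
    {X Y : (coinverter p).based.obj} (m : X ⟶ Y)
    (hm : (coinverter p).based.p.IsHomLift (𝟙 ((coinverter p).based.p.obj X)) m) :
    IsOpcartesian (functor (fromCoinverter p)) m := by
  obtain ⟨x, rfl⟩ := toCoinverter_obj_surjective p X
  have h1 : C.based.p.IsHomLift (𝟙 (C.based.p.obj ((functor p).obj x)))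
      ((functor (fromCoinverter p)).map m) := by
    have h := (fromCoinverter p).toBased.preserves_isHomLift
      (𝟙 ((coinverter p).based.p.obj ((functor (toCoinverter p)).obj x))) m
    exact isHomLift_id_obj rfl rfl h
  obtain ⟨y, e, he⟩ := hp x _ ((functor (fromCoinverter p)).map m) h1
  have h2 : (functor (fromCoinverter p)).IsStronglyCocartesian
      ((functor (fromCoinverter p)).map m) ((functor (toCoinverter p)).map e) :=
    isStronglyCocartesian_toCoinverter_map p hp he h1
  obtain ⟨χ, ⟨hχ, h3⟩, -⟩ := IsStronglyCocartesian.universal_property (functor (fromCoinverter p))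
    ((functor (fromCoinverter p)).map m) ((functor (toCoinverter p)).map e) (𝟙 _) _
    (Category.comp_id _).symm m
  have hχ' : IsIso χ := isIso_of_isIso_map_fromCoinverter p hp χ
    (hχ.isIso_map_iff.2 inferInstance)
  have h4 : (functor (fromCoinverter p)).IsStronglyCocartesian
    ((functor (fromCoinverter p)).map m ≫ 𝟙 _) ((functor (toCoinverter p)).map e ≫ χ) := by
    have := IsStronglyCocartesian.of_isIso (functor (fromCoinverter p))
      (𝟙 ((functor (fromCoinverter p)).obj Y)) χ
    infer_instance
  rw [h3, Category.comp_id] at h4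
  exact h4

/-- The comma objects of `fromCoinverter p` and `p` have the same objects, since the coinverter has
the same objects as `A`. -/
noncomputable def CommaObj.ofCoinverter (e : CommaObj (fromCoinverter p) C.verticalArrows) :
    CommaObj p C.verticalArrows :=
  ⟨(Localization.Construction.objEquiv (functor p).identityArrows).symm e.left, e.right, e.hom,
    e.mem⟩

theorem CommaObj.ofCoinverter_reindex {R S : B} (β : R ⟶ S)
    (e : CommaObj (fromCoinverter p) C.verticalArrows)
    (he : (coinverter p).based.p.obj e.left = S) :
    ofCoinverter (e.reindex (isStable_verticalArrows C) β he) =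
      (ofCoinverter e).reindex (isStable_verticalArrows C) β he := by
  refine eq_reindex (c := ofCoinverter (e.reindex (isStable_verticalArrows C) β he))
    (a := ofCoinverter e) (isStable_verticalArrows C) β he rfl rfl ?_
  have h1 := e.reindexHom_lift (isStable_verticalArrows C) β he
  have h2 : (functor (fromCoinverter p)).map ((coinverter p).cleavage.lift β e.left he) =
      (functor p).map (A.cleavage.lift β (ofCoinverter e).left he) := by
    have h3 := Functor.congr_hom (Localization.Construction.fac (functor p)
      (identityArrows_isInvertedBy p)) (A.cleavage.lift β (ofCoinverter e).left he)
    exact h3.trans ((Category.id_comp _).trans (Category.comp_id _))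
  have h4 : (functor (fromCoinverter p)).map ((coinverter p).cleavage.lift β e.left he) ≫ e.hom =
    (functor p).map (A.cleavage.lift β (ofCoinverter e).left he) ≫ (ofCoinverter e).hom :=
    congrArg (· ≫ e.hom) h2
  refine Eq.trans ?_ (h4.trans (Category.id_comp _).symm)
  refine Eq.trans ?_ h1
  exact congrArg _ (Category.id_comp _)

/-- The pushforwards for `fromCoinverter p` are the images of those for `p`, which commute with the
chosen lifts because the pushforward 1-cell preserves the cleavages. -/
theorem _root_.TwoCategory.IsInternalOpfibration.nonempty_cleavedPushforward
    (hp : IsInternalOpfibration p) : Nonempty (CleavedPushforward (fromCoinverter p)) := by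
  obtain ⟨L, lam, h⟩ := hp.exists_pushforward
  let lam' : ∀ e : CommaObj p C.verticalArrows, e.left ⟶ (functor L).obj e := fun e => app lam e
  refine ⟨⟨fun e => (functor (toCoinverter p)).obj ((functor L).obj (CommaObj.ofCoinverter e)),
    fun e => (functor (toCoinverter p)).map (lam' (CommaObj.ofCoinverter e)), fun e => ?_,
    fun {R S} β e he he' => ?_⟩⟩
  · exact isStronglyCocartesian_toCoinverter_map p hp.hasVerticalPushforwards
      (h (CommaObj.ofCoinverter e))
      (CommaObj.isHomLift_hom (isStable_verticalArrows C) (CommaObj.ofCoinverter e))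
  · obtain ⟨h1, e1⟩ := L.map_lift β (CommaObj.ofCoinverter e) he
    have e2 : lam' ((CommaObj.ofCoinverter e).reindex (isStable_verticalArrows C) β he) ≫
        eqToHom h1 ≫ A.cleavage.lift β ((functor L).obj (CommaObj.ofCoinverter e)) he' =
          A.cleavage.lift β (CommaObj.ofCoinverter e).left he ≫ lam' (CommaObj.ofCoinverter e) := by
      refine Eq.trans (congrArg (lam' _ ≫ ·) e1.symm) ?_
      exact (app_naturality lam
        (CommaObj.reindexLift (isStable_verticalArrows C) β (CommaObj.ofCoinverter e) he)).symm
    have e3 : ∀ (e' : CommaObj p C.verticalArrows)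
        (hre : e' = (CommaObj.ofCoinverter e).reindex (isStable_verticalArrows C) β he),
        lam' e' ≫ eqToHom ((congrArg (functor L).obj hre).trans h1) ≫ A.cleavage.lift β
          ((functor L).obj (CommaObj.ofCoinverter e)) he' =
            eqToHom (congrArg CommaObj.left hre) ≫
              A.cleavage.lift β (CommaObj.ofCoinverter e).left he ≫
                lam' (CommaObj.ofCoinverter e) := by
      rintro _ rfl
      exact e2.trans (Category.id_comp _).symm
    have e4 := (e3 _ (CommaObj.ofCoinverter_reindex β e he)).trans (Category.id_comp _)
    have e5 := congrArg (functor (toCoinverter p)).map e4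
    rw [Functor.map_comp, Functor.map_comp, eqToHom_map] at e5
    exact ⟨_, e5.trans ((functor (toCoinverter p)).map_comp _ _)⟩

theorem isInternalOpfibrationInGroupoids_fromCoinverter (hp : IsInternalOpfibration p) :
    IsInternalOpfibrationInGroupoids (fromCoinverter p) := by
  obtain ⟨P⟩ := hp.nonempty_cleavedPushforward
  refine ⟨isInternalOpfibration_of_cleavedPushforward _ P fun m hm =>
    isOpcartesian_fromCoinverter hp.hasVerticalPushforwards m hm, _, _, _, _, isIdentee _, ?_⟩
  refine isIso_of_app _ fun e =>
    isIso_of_isIso_map_fromCoinverter p hp.hasVerticalPushforwards _ ?_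
  have h : (functor (fromCoinverter p)).identityArrows (CommaObj.hom e) := CommaObj.mem e
  exact identityArrows_isInvertedBy (fromCoinverter p) _ h

end Coinverter

end Fib

theorem mainTheorem1 {B : Type u₁} [Category.{v₁} B] {A C : Fib.{u} B} (p : A ⟶ C) :
    (Fib.IsFibrewiseOpfibration p →
      ∃ (Q : Fib.{u} B) (q : A ⟶ Q) (s : Q ⟶ C),
        q ≫ s = p ∧ TwoCategory.IsCoinverterOfIdentee p q ∧
          Fib.IsFibrewiseOpfibrationInGroupoids s) ∧
    (TwoCategory.IsInternalOpfibration p →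
      ∃ (Q : Fib.{u} B) (q : A ⟶ Q) (s : Q ⟶ C),
        q ≫ s = p ∧ TwoCategory.IsCoinverterOfIdentee p q ∧
          TwoCategory.IsInternalOpfibrationInGroupoids s) := by
  exact ⟨fun hp => ⟨_, Fib.toCoinverter p, Fib.fromCoinverter p, Fib.toCoinverter_fromCoinverter p,
      Fib.isCoinverterOfIdentee p,
      Fib.isFibrewiseOpfibrationInGroupoids_fromCoinverter p hp.hasVerticalPushforwards⟩,
    fun hp => ⟨_, Fib.toCoinverter p, Fib.fromCoinverter p, Fib.toCoinverter_fromCoinverter p,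
      Fib.isCoinverterOfIdentee p, Fib.isInternalOpfibrationInGroupoids_fromCoinverter hp⟩⟩
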